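/- **Conventions.** For a semi-Riemannian metric $g$ on an $N$-manifold, a smooth function $\phi$ and $\lambda\in\mathbb R$ put $$P_\phi=\mathrm{Ric}+\nabla^2\phi-\lambda g,\quad F_\phi=\Delta\phi-|\nabla\phi|^2+2\lambda\phi-N\lambda,\quad v_{1,\phi}=\tfrac12\big(R+2\Delta\phi-|\nabla\phi|^2+2\lambda(\phi-N)\big).$$ Let $M$ be a smooth $n$-manifold. A *normal global weighted ambient space* $(\widetilde{\mathcal G},\widetilde g,\widetilde\phi,\lambda)$ over $M$ consists of an open set $\widetilde{\mathcal G}\subset\mathbb R\times M\times\mathbb R$ (points $(v,x,u)$) containing $\{u=0\}$, such that for all $(v,x)$ the set $\{u:(v,x,u)\in\widetilde{\mathcal G}\}$ is an interval and such that the dilations $\delta_t(v,x,u)=(v+(\lambda u-1)^{-1}t,x,u)$ are defined on $\widetilde{\mathcal G}$ (i.e. $\lambda u\ne1$ there) and preserve it, together with smooth $$\widetilde g=2\,du\,dv+g_u,\qquad \widetilde\phi=\phi_u-v+\lambda uv,$$ with $g_u$ a family of Riemannian metrics and $\phi_u$ a family of functions on (open subsets of) $M$, satisfying $\widetilde P_{\phi}=0$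 and $\widetilde F_{\phi}=0$ on $\widetilde{\mathcal G}$ (here $N=n+2$). **Theorem.** Let $\tau>0$, $\varepsilon>0$, and let $(\widetilde{\mathcal G},\widetilde g,\widetilde\phi,(2\tau)^{-1})$ be a normal global weighted ambient space over $M$ with families $g_u,\phi_u$. For $s\in(-\varepsilon,\tau)$ put $\tau(s)=(1-s/\tau)\tau$, $\lambda(s)=(2\tau(s))^{-1}$, $u(s)=(1-s/\tau)u$ and $$g_{u(s)}(s)=(1-s/\tau)\,g_u,\qquad \phi_{u(s)}(s)=\phi_u,\qquad \widetilde\phi(s)=\phi_{u(s)}(s)-v+\lambda(s)u(s)v,\qquad \widetilde g(s)=2\,du(s)\,dv+g_{u(s)}(s).$$ Then for each $s$ the normal coordinates $(v,x,u(s))$ and $\widetilde g(s),\widetilde\phi(s),\lambda(s)$ define a normal global weighted ambient space. On $\widetilde{\mathcal G}\times(-\varepsilon,\tau)$, with coordinates $(v,x^i,u,s)$, consider the vector field $$Y=\big(1-\lambda(s)u(s)\big)^{-1}(v_{1,\phi})_{u(s)}\,\partial_v-\big(1-\lambda(s)u(s)\big)\,\partial_{u(s)}+\partial_s ,\qquad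 \partial_{u(s)}=(1-s/\tau)^{-1}\partial_u ,$$ where $\partial_s$ is taken at fixed $(v,x,u)$. Write $g=g_{u(s)}(s)$ (a tensor on the product that annihilates $\partial_v,\partial_u,\partial_s$), $\phi=\widetilde\phi(s)$ and $\tau=\tau(s)$ for the resulting tensor and functions on $\widetilde{\mathcal G}\times(-\varepsilon,\tau)$, where $\mathrm{Ric}$, $R$, $\nabla^2\phi$, $\Delta\phi$ and $(v_{1,\phi})_{u(s)}$ are those of $(g_{u(s)}(s),\ \widetilde\phi(s)(v,\cdot,u(s)),\ \lambda(s))$ on $M$ at fixed $v,u,s$ (so $N=n$ in $v_{1,\phi}$). Then at every point the $\mathcal W$-gradient Ricci flow equations hold along $Y$: $$L_Yg=-2(\mathrm{Ric}+\nabla^2\phi),\qquad L_Y\phi=-R-\Delta\phi+\frac{n}{2\tau},\qquad L_Y\tau=-1.$$ (The right-hand side of the first equation is extended by zero to $\partial_v,\partial_u,\partial_s$.) -/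

import Mathlib

open scoped Manifold ContDiff

noncomputable section

namespace WeightedAmbient

/-! ### Coordinate formulas on a finite-dimensional vector space `E` with a basis `b` -/

section Coordinates

variable {ι E : Type*} [Fintype ι] [DecidableEq ι] [NormedAddCommGroup E] [NormedSpace ℝ E]

/-- The partial derivative `∂ᵢ f`. -/
def pd (b : Module.Basis ι ℝ E) (i : ι) (f : E → ℝ) (y : E) : ℝ := fderiv ℝ f y (b i)

/-- The Christoffel symbols `Γᵏᵢⱼ = ½ gᵏˡ (∂ᵢ gⱼₗ + ∂ⱼ gᵢₗ - ∂ₗ gᵢⱼ)` of a field `G` of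
nondegenerate symmetric matrices (of any signature). -/
def christoffel (b : Module.Basis ι ℝ E) (G : E → Matrix ι ι ℝ) (k i j : ι) (y : E) : ℝ :=
  (1 / 2) * ∑ l, (G y)⁻¹ k l *
    (pd b i (fun z => G z j l) y + pd b j (fun z => G z i l) y - pd b l (fun z => G z i j) y)

/-- The components of the Ricci tensor:
`Rᵢⱼ = ∂ₖ Γᵏᵢⱼ - ∂ⱼ Γᵏᵢₖ + Γᵏₖₗ Γˡᵢⱼ - Γᵏⱼₗ Γˡᵢₖ`. -/
def ricciCoord (b : Module.Basis ι ℝ E) (G : E → Matrix ι ι ℝ) (i j : ι) (y : E) : ℝ :=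
  ∑ k, pd b k (christoffel b G k i j) y - ∑ k, pd b j (christoffel b G k i k) y
    + ∑ k, ∑ l, (christoffel b G k k l y * christoffel b G l i j y
        - christoffel b G k j l y * christoffel b G l i k y)

/-- The components of the Hessian: `∇ᵢ∇ⱼ f = ∂ᵢ∂ⱼ f - Γᵏᵢⱼ ∂ₖ f`. -/
def hessCoord (b : Module.Basis ι ℝ E) (G : E → Matrix ι ι ℝ) (f : E → ℝ) (i j : ι) (y : E) : ℝ :=
  pd b i (pd b j f) y - ∑ k, christoffel b G k i j y * pd b k f y

end Coordinates

/-! ### Tensors on manifolds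

The tangent space at `p` is the model vector space `E`, identified with it through the preferred
chart at `p`; a basis `b` of `E` is therefore the coordinate basis at `p` of that chart.  All
tensors below are evaluated at `p` in the preferred chart at `p`.  Manifolds have no boundary
and no corners here: the models used are `𝓡 n`, `𝓘(ℝ, ℝ)` and their products. -/

section Manifold

variable {ι E H N : Type*} [Fintype ι] [DecidableEq ι] [NormedAddCommGroup E] [NormedSpace ℝ E]
  [TopologicalSpace H] [TopologicalSpace N] [ChartedSpace H N]

/-- A field of bilinear forms on the tangent spaces. -/
abbrev TwoTensor (I : ModelWithCorners ℝ E H) (N : Type*) [TopologicalSpace N]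
    [ChartedSpace H N] : Type _ :=
  (p : N) → LinearMap.BilinForm ℝ (TangentSpace I p)

/-- The coordinate vector field `∂ᵢ` of the chart at `p`, at the point `q` with coordinates `y`.
As `T_q N` is `E` through the chart at `q`, this is the derivative at `y` of the transition map
from the chart at `p` to the chart at `q`, applied to `b i`. -/
def coordVector (I : ModelWithCorners ℝ E H) (b : Module.Basis ι ℝ E) (p : N) (i : ι) (y : E) :
    TangentSpace I ((extChartAt I p).symm y) :=
  (fderiv ℝ (fun z => extChartAt I ((extChartAt I p).symm y) ((extChartAt I p).symm z)) y (b i) : E)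

/-- The component matrix of a 2-tensor in the chart at `p`. -/
def coordTensor (I : ModelWithCorners ℝ E H) (b : Module.Basis ι ℝ E) (h : TwoTensor I N) (p : N)
    (y : E) : Matrix ι ι ℝ :=
  Matrix.of fun i j => h _ (coordVector I b p i y) (coordVector I b p j y)

/-- A function read in the chart at `p`. -/
def coordFun (I : ModelWithCorners ℝ E H) (f : N → ℝ) (p : N) (y : E) : ℝ :=
  f ((extChartAt I p).symm y)

/-- The components of a vector field in the chart at `p`, at the point `q` with coordinates `y`;
the vector at `q`, an element of `E` through the chart at `q`, is taken to the chart at `p`. -/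
def coordField (I : ModelWithCorners ℝ E H) (b : Module.Basis ι ℝ E)
    (Y : (q : N) → TangentSpace I q) (p : N) (k : ι) (y : E) : ℝ :=
  b.repr (fderiv ℝ (fun z => extChartAt I p ((extChartAt I ((extChartAt I p).symm y)).symm z))
    (extChartAt I ((extChartAt I p).symm y) ((extChartAt I p).symm y))
    (Y ((extChartAt I p).symm y) : E)) k

/-- The bilinear form on the tangent space at `p` with components `c` in the basis `b`. -/
def evalComponents (I : ModelWithCorners ℝ E H) (b : Module.Basis ι ℝ E) (p : N) (c : ι → ι → ℝ)
    (X Y : TangentSpace I p) : ℝ :=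
  ∑ i, ∑ j, c i j * b.repr (X : E) i * b.repr (Y : E) j

/-- A 2-tensor is smooth on `S` if its components in charts are. -/
def IsSmoothOn (I : ModelWithCorners ℝ E H) (b : Module.Basis ι ℝ E) (h : TwoTensor I N)
    (S : Set N) : Prop :=
  ∀ p : N, ∀ i j : ι, ContDiffOn ℝ ∞ (fun y => coordTensor I b h p y i j)
    ((extChartAt I p).target ∩ (extChartAt I p).symm ⁻¹' S)

/-- The Ricci tensor of the metric `h`. -/
def ricci (I : ModelWithCorners ℝ E H) (b : Module.Basis ι ℝ E) (h : TwoTensor I N) (p : N)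
    (X Y : TangentSpace I p) : ℝ :=
  evalComponents I b p
    (fun i j => ricciCoord b (coordTensor I b h p) i j (extChartAt I p p)) X Y

/-- The Hessian `∇² f`. -/
def hess (I : ModelWithCorners ℝ E H) (b : Module.Basis ι ℝ E) (h : TwoTensor I N) (f : N → ℝ)
    (p : N) (X Y : TangentSpace I p) : ℝ :=
  evalComponents I b p
    (fun i j => hessCoord b (coordTensor I b h p) (coordFun I f p) i j (extChartAt I p p)) X Y

/-- The scalar curvature `R`. -/
def scalar (I : ModelWithCorners ℝ E H) (b : Module.Basis ι ℝ E) (h : TwoTensor I N) (p : N) : ℝ :=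
  ∑ i, ∑ j, (coordTensor I b h p (extChartAt I p p))⁻¹ i j *
    ricciCoord b (coordTensor I b h p) i j (extChartAt I p p)

/-- The Laplacian `Δ f`, the trace of the Hessian. -/
def laplacian (I : ModelWithCorners ℝ E H) (b : Module.Basis ι ℝ E) (h : TwoTensor I N)
    (f : N → ℝ) (p : N) : ℝ :=
  ∑ i, ∑ j, (coordTensor I b h p (extChartAt I p p))⁻¹ i j *
    hessCoord b (coordTensor I b h p) (coordFun I f p) i j (extChartAt I p p)

/-- The squared length `|∇ f|²` of the gradient. -/
def gradSq (I : ModelWithCorners ℝ E H) (b : Module.Basis ι ℝ E) (h : TwoTensor I N) (f : N → ℝ)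
    (p : N) : ℝ :=
  ∑ i, ∑ j, (coordTensor I b h p (extChartAt I p p))⁻¹ i j *
    pd b i (coordFun I f p) (extChartAt I p p) * pd b j (coordFun I f p) (extChartAt I p p)

/-- `Ric_φ = Ric + ∇² φ`. -/
def weightedRicci (I : ModelWithCorners ℝ E H) (b : Module.Basis ι ℝ E) (h : TwoTensor I N)
    (φ : N → ℝ) (p : N) (X Y : TangentSpace I p) : ℝ :=
  ricci I b h p X Y + hess I b h φ p X Y

/-- `P_φ = Ric_φ - λ g`. -/
def weightedP (I : ModelWithCorners ℝ E H) (b : Module.Basis ι ℝ E) (h : TwoTensor I N)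
    (φ : N → ℝ) (lam : ℝ) (p : N) (X Y : TangentSpace I p) : ℝ :=
  weightedRicci I b h φ p X Y - lam * h p X Y

/-- `F_φ = Δ φ - |∇ φ|² + 2 λ φ - (dim) λ`. -/
def weightedF (I : ModelWithCorners ℝ E H) (b : Module.Basis ι ℝ E) (h : TwoTensor I N)
    (φ : N → ℝ) (lam : ℝ) (p : N) : ℝ :=
  laplacian I b h φ p - gradSq I b h φ p + 2 * lam * φ p - Fintype.card ι * lam

/-- `R_φ = R + 2 Δ φ - |∇ φ|² + 2 λ (φ - dim)`. -/
def weightedScalar (I : ModelWithCorners ℝ E H) (b : Module.Basis ι ℝ E) (h : TwoTensor I N)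
    (φ : N → ℝ) (lam : ℝ) (p : N) : ℝ :=
  scalar I b h p + 2 * laplacian I b h φ p - gradSq I b h φ p
    + 2 * lam * (φ p - Fintype.card ι)

/-- `v_{1,φ} = ½ R_φ`. -/
def v₁ (I : ModelWithCorners ℝ E H) (b : Module.Basis ι ℝ E) (h : TwoTensor I N)
    (φ : N → ℝ) (lam : ℝ) (p : N) : ℝ :=
  (1 / 2) * weightedScalar I b h φ lam p

/-- The Lie derivative of a function. -/
def lieFun (I : ModelWithCorners ℝ E H) (Y : (q : N) → TangentSpace I q) (f : N → ℝ) (p : N) : ℝ :=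
  mfderiv I 𝓘(ℝ, ℝ) f p (Y p)

/-- The Lie derivative of a 2-tensor:
`(L_Y h)ᵢⱼ = Yᵏ ∂ₖ hᵢⱼ + hₖⱼ ∂ᵢ Yᵏ + hᵢₖ ∂ⱼ Yᵏ`. -/
def lieTensor (I : ModelWithCorners ℝ E H) (b : Module.Basis ι ℝ E)
    (Y : (q : N) → TangentSpace I q) (h : TwoTensor I N) (p : N) (A B : TangentSpace I p) : ℝ :=
  evalComponents I b p (fun i j =>
    ∑ k, (coordField I b Y p k (extChartAt I p p) *
            pd b k (fun y => coordTensor I b h p y i j) (extChartAt I p p)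
        + coordTensor I b h p (extChartAt I p p) k j *
            pd b i (coordField I b Y p k) (extChartAt I p p)
        + coordTensor I b h p (extChartAt I p p) i k *
            pd b j (coordField I b Y p k) (extChartAt I p p))) A B

end Manifold

/-! ### The spaces `M`, `ℝ × M × ℝ` (coordinates `v, x, u`) and `(ℝ × M × ℝ) × ℝ`
(coordinates `v, x, u, s`) -/

/-- The standard basis of the model space of an `n`-manifold. -/
def baseBasis (n : ℕ) : Module.Basis (Fin n) ℝ (EuclideanSpace ℝ (Fin n)) :=
  (EuclideanSpace.basisFun (Fin n) ℝ).toBasis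

/-- The model of `ℝ × M × ℝ`. -/
abbrev ambI (n : ℕ) := 𝓘(ℝ, ℝ).prod ((𝓡 n).prod 𝓘(ℝ, ℝ))

/-- The basis `∂_v, ∂_i, ∂_u`. -/
def ambBasis (n : ℕ) :
    Module.Basis (Unit ⊕ (Fin n ⊕ Unit)) ℝ (ℝ × EuclideanSpace ℝ (Fin n) × ℝ) :=
  (Module.Basis.singleton Unit ℝ).prod ((baseBasis n).prod (Module.Basis.singleton Unit ℝ))

/-- The model of `(ℝ × M × ℝ) × ℝ`. -/
abbrev totI (n : ℕ) := (ambI n).prod 𝓘(ℝ, ℝ)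

/-- The basis `∂_v, ∂_i, ∂_u, ∂_s`. -/
def totBasis (n : ℕ) :
    Module.Basis ((Unit ⊕ (Fin n ⊕ Unit)) ⊕ Unit) ℝ
      ((ℝ × EuclideanSpace ℝ (Fin n) × ℝ) × ℝ) :=
  (ambBasis n).prod (Module.Basis.singleton Unit ℝ)

/-- The linear functional `dv` on the model space of `ℝ × M × ℝ`. -/
def dv (n : ℕ) : (ℝ × EuclideanSpace ℝ (Fin n) × ℝ) →ₗ[ℝ] ℝ := LinearMap.fst ℝ _ _

/-- The linear projection `dx` from the model space of `ℝ × M × ℝ` to that of `M`. -/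
def dx (n : ℕ) : (ℝ × EuclideanSpace ℝ (Fin n) × ℝ) →ₗ[ℝ] EuclideanSpace ℝ (Fin n) :=
  LinearMap.fst ℝ _ _ ∘ₗ LinearMap.snd ℝ _ _

/-- The linear functional `du` on the model space of `ℝ × M × ℝ`. -/
def du (n : ℕ) : (ℝ × EuclideanSpace ℝ (Fin n) × ℝ) →ₗ[ℝ] ℝ :=
  LinearMap.snd ℝ _ _ ∘ₗ LinearMap.snd ℝ _ _

/-- The data of a space in normal form: a set `carrier` of points `(v, x, u)`, and families
`g_u = metric u` and `φ_u = density u` on `M`, of which only the values at `x` with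
`(v, x, u) ∈ carrier` matter. -/
structure NormalSpace (n : ℕ) (M : Type*) [TopologicalSpace M]
    [ChartedSpace (EuclideanSpace ℝ (Fin n)) M] where
  carrier : Set (ℝ × M × ℝ)
  metric : ℝ → TwoTensor (𝓡 n) M
  density : ℝ → M → ℝ

namespace NormalSpace

variable {n : ℕ} {M : Type*} [TopologicalSpace M] [ChartedSpace (EuclideanSpace ℝ (Fin n)) M]

/-- `g̃ = 2 du dv + g_u`. -/
def ambMetric (A : NormalSpace n M) : TwoTensor (ambI n) (ℝ × M × ℝ) := fun p =>
  ((LinearMap.mul ℝ ℝ).compl₁₂ (du n) (dv n) + (LinearMap.mul ℝ ℝ).compl₁₂ (dv n) (du n)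
    + LinearMap.compl₁₂ (A.metric p.2.2 p.2.1 : LinearMap.BilinForm ℝ (EuclideanSpace ℝ (Fin n)))
        (dx n) (dx n) :
    LinearMap.BilinForm ℝ (ℝ × EuclideanSpace ℝ (Fin n) × ℝ))

/-- `φ̃ = φ_u - v + λ u v`. -/
def ambDensity (A : NormalSpace n M) (lam : ℝ) : ℝ × M × ℝ → ℝ := fun p =>
  A.density p.2.2 p.2.1 - p.1 + lam * p.2.2 * p.1

/-- `(G̃, g̃, φ̃, λ)` is a normal global weighted ambient space.  The dilations are
`δ_t (v, x, u) = (v + (λ u - 1)⁻¹ t, x, u)`. -/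
structure IsGlobalAmbient (A : NormalSpace n M) (lam : ℝ) : Prop where
  isOpen_carrier : IsOpen A.carrier
  zero_mem : ∀ (v : ℝ) (x : M), (v, x, (0 : ℝ)) ∈ A.carrier
  interval : ∀ (v : ℝ) (x : M), {u : ℝ | (v, x, u) ∈ A.carrier}.OrdConnected
  dilation_defined : ∀ p ∈ A.carrier, lam * p.2.2 - 1 ≠ 0
  dilation_mem : ∀ p ∈ A.carrier, ∀ t : ℝ,
    (p.1 + (lam * p.2.2 - 1)⁻¹ * t, p.2.1, p.2.2) ∈ A.carrier
  symm : ∀ p ∈ A.carrier, ∀ X Y : TangentSpace (𝓡 n) p.2.1,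
    A.metric p.2.2 p.2.1 X Y = A.metric p.2.2 p.2.1 Y X
  pos : ∀ p ∈ A.carrier, ∀ X : TangentSpace (𝓡 n) p.2.1, X ≠ 0 → 0 < A.metric p.2.2 p.2.1 X X
  smooth_metric : IsSmoothOn (ambI n) (ambBasis n) A.ambMetric A.carrier
  smooth_density : ContMDiffOn (ambI n) 𝓘(ℝ, ℝ) ∞ (A.ambDensity lam) A.carrier
  P_eq_zero : ∀ p ∈ A.carrier, ∀ X Y : TangentSpace (ambI n) p,
    weightedP (ambI n) (ambBasis n) A.ambMetric (A.ambDensity lam) lam p X Y = 0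
  F_eq_zero : ∀ p ∈ A.carrier,
    weightedF (ambI n) (ambBasis n) A.ambMetric (A.ambDensity lam) lam p = 0

/-- The density of the manifold with density `(M, g_u, φ̃(v, ·, u), λ)` which sits in the ambient
space at constant `v` and `u`. -/
def leafDensity (A : NormalSpace n M) (lam v u : ℝ) : M → ℝ := fun x => A.ambDensity lam (v, x, u)

/-! #### The one-parameter family obtained by rescaling -/

/-- `τ(s) = (1 - s/τ) τ`. -/
def tauAt (τ s : ℝ) : ℝ := (1 - s / τ) * τ

/-- `λ(s) = (2 τ(s))⁻¹`. -/
def lamAt (τ s : ℝ) : ℝ := (2 * tauAt τ s)⁻¹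

/-- `u(s) = (1 - s/τ) u`. -/
def uAt (τ s u : ℝ) : ℝ := (1 - s / τ) * u

/-- The member with parameter `s` of the family, in its own normal coordinates `(v, x, u(s))`:
`g_{u(s)}(s) = (1 - s/τ) g_u` and `φ_{u(s)}(s) = φ_u` for `u(s) = (1 - s/τ) u`. -/
def slice (A : NormalSpace n M) (τ s : ℝ) : NormalSpace n M where
  carrier := {p | (p.1, p.2.1, p.2.2 / (1 - s / τ)) ∈ A.carrier}
  metric := fun w x => (1 - s / τ) • A.metric (w / (1 - s / τ)) x
  density := fun w x => A.density (w / (1 - s / τ)) x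

/-! On the total space, the point `((v, x, u), s)` is the point `(v, x, u(s))` of the slice with
parameter `s`. -/

/-- The (degenerate) tensor `g = g_{u(s)}(s)` on the total space. -/
def totMetric (A : NormalSpace n M) (τ : ℝ) : TwoTensor (totI n) ((ℝ × M × ℝ) × ℝ) := fun q =>
  (LinearMap.compl₁₂
      ((A.slice τ q.2).metric (uAt τ q.2 q.1.2.2) q.1.2.1 :
        LinearMap.BilinForm ℝ (EuclideanSpace ℝ (Fin n)))
      (dx n ∘ₗ LinearMap.fst ℝ _ ℝ) (dx n ∘ₗ LinearMap.fst ℝ _ ℝ) :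
    LinearMap.BilinForm ℝ ((ℝ × EuclideanSpace ℝ (Fin n) × ℝ) × ℝ))

/-- The function `φ̃(s)` on the total space. -/
def totDensity (A : NormalSpace n M) (τ : ℝ) : (ℝ × M × ℝ) × ℝ → ℝ := fun q =>
  (A.slice τ q.2).ambDensity (lamAt τ q.2) (q.1.1, q.1.2.1, uAt τ q.2 q.1.2.2)

/-- The function `τ` on the total space. -/
def totTau (M : Type*) (τ : ℝ) : (ℝ × M × ℝ) × ℝ → ℝ := fun q => tauAt τ q.2

/-- The function `(v_{1,φ})_{u(s)}` on the total space: its value at a point is `v_{1,φ}` of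
the manifold with density `(M, g_{u(s)}(s), φ̃(s)(v, ·, u(s)), λ(s))` through that point. -/
def totV₁ (A : NormalSpace n M) (τ : ℝ) : (ℝ × M × ℝ) × ℝ → ℝ := fun q =>
  v₁ (𝓡 n) (baseBasis n) ((A.slice τ q.2).metric (uAt τ q.2 q.1.2.2))
    ((A.slice τ q.2).leafDensity (lamAt τ q.2) q.1.1 (uAt τ q.2 q.1.2.2)) (lamAt τ q.2) q.1.2.1

/-- The vector field
`Y = (1 - λ(s) u(s))⁻¹ (v_{1,φ})_{u(s)} ∂_v - (1 - λ(s) u(s)) ∂_{u(s)} + ∂_s`,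
with `∂_{u(s)} = (1 - s/τ)⁻¹ ∂_u` in the coordinates `((v, x, u), s)`. -/
def flowField (A : NormalSpace n M) (τ : ℝ) (q : (ℝ × M × ℝ) × ℝ) : TangentSpace (totI n) q :=
  (((1 - lamAt τ q.2 * uAt τ q.2 q.1.2.2)⁻¹ * A.totV₁ τ q,
    (0 : EuclideanSpace ℝ (Fin n)),
    -(1 - lamAt τ q.2 * uAt τ q.2 q.1.2.2) * (1 - q.2 / τ)⁻¹), (1 : ℝ))

end NormalSpace

end WeightedAmbient

end

noncomputable section

namespace WeightedAmbient

open Filter Topology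

/-! ### Locality, scaling and smoothness of the coordinate formulas -/

section Coordinates

variable {ι E : Type*} [NormedAddCommGroup E] [NormedSpace ℝ E]

/-! Two facts about the normal form carry the proof. First, `2 du dv + g_u` has parallel null field
`∂_v`, and the only ambient correction to the geometry of a leaf `{v, u constant}` comes from `Γᵛᵢⱼ
= -½ ∂_u gᵢⱼ`. Since `∂_v φ̃ = -(1 - λu)`, the tangential part of `P̃ = 0` reads `Ric + ∇²φ = ½(1 -
λu) ∂_u g + λ g` on each leaf (`leaf_P`). Because `2 ∂_u∂_v φ̃ = 2λ`, the equation `F̃ = 0` together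
with the trace of the previous one gives `2(1 - λu) ∂_u φ̃ = R + |∇φ|² - 2λφ̃` (`leaf_F`).

Second, put `c = 1 - s/τ`. The member with parameter `s` is the original space pulled back by `w ↦ w
/ c`, with metric multiplied by `c` and `λ` divided by `c`; the density is only pulled back, because
`λ(s) u(s) = λ u`. Ricci tensor and Hessian ignore a constant factor, `λ g̃` is unchanged, and `F̃`
is multiplied by `c⁻¹`, so the ambient equations persist (`IsGlobalAmbient.slice`).

The flow then follows by applying both leaf equations to the slice. The tensor `g` is `c g_u` and
has only `dx dx` components, and `Y` has no `dx` component, so `L_Y g` just differentiates the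
components: `-(1 - λu) ∂_u g_u - g_u / τ`, which is `-2(Ric + ∇²φ)` by `leaf_P` (`flow_metric`,
`lieTensor_totMetric`). The function `φ̃(s)` does not depend on `s` at fixed `(v, x, u)`, and `Yφ̃ =
-v₁ - (1 - λu) ∂_{u(s)} φ̃`; by `leaf_F` the terms in `|∇φ|²` and `φ̃` cancel and `-R - Δφ + nλ(s)`
remains (`lieFun_totDensity`). -/

theorem pd_congr {b : Module.Basis ι ℝ E} {f g : E → ℝ} {y : E} (h : f =ᶠ[𝓝 y] g) (i : ι) :
    pd b i f y = pd b i g y := by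
  simp only [pd, h.fderiv_eq]

theorem pd_const_mul (b : Module.Basis ι ℝ E) (i : ι) (c : ℝ) (f : E → ℝ) (y : E) :
    pd b i (fun z => c * f z) y = c * pd b i f y := by
  have := congrFun (fderiv_const_smul_field (𝕜 := ℝ) (f := f) c) y
  have h2 : (fun z => c * f z) = c • f := by ext z; simp
  simp [pd, h2, this]

theorem pd_comp_equiv (b : Module.Basis ι ℝ E) {L : E ≃L[ℝ] E} {d : ι → ℝ}
    (hL : ∀ i, L (b i) = d i • b i) (i : ι) (f : E → ℝ) (y : E) :
    pd b i (fun z => f (L z)) y = d i * pd b i f (L y) := by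
  have := L.comp_right_fderiv (f := f) (x := y)
  have h2 : (fun z => f (L z)) = f ∘ L := rfl
  simp [pd, h2, this, hL]

theorem contDiffOn_pd (b : Module.Basis ι ℝ E) (i : ι) {f : E → ℝ} {U : Set E} (hU : IsOpen U)
    (hf : ContDiffOn ℝ ∞ f U) : ContDiffOn ℝ ∞ (pd b i f) U :=
  (hf.fderiv_of_isOpen hU (by simp)).clm_apply contDiffOn_const

theorem pd_comm (b : Module.Basis ι ℝ E) (i j : ι) {f : E → ℝ} {y : E}
    (hf : ContDiffAt ℝ ∞ f y) : pd b i (pd b j f) y = pd b j (pd b i f) y := by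
  have hd : DifferentiableAt ℝ (fderiv ℝ f) y :=
    (hf.fderiv_right (m := 1) (by norm_cast)).differentiableAt (by norm_num)
  have h2 : ∀ i j, pd b i (pd b j f) y = fderiv ℝ (fderiv ℝ f) y (b i) (b j) := fun i j => by
    have : pd b j f = fun z => fderiv ℝ f z (b j) := rfl
    rw [this, pd, fderiv_clm_apply hd (differentiableAt_const _)]
    simp
  rw [h2, h2]
  exact (hf.isSymmSndFDerivAt (by
    rw [minSmoothness_of_isRCLikeNormedField]; norm_cast)).eq _ _

/-- A function invariant under translations along `bᵢ` has vanishing `i`-th derivative. -/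
theorem pd_eq_zero_of_invariant (b : Module.Basis ι ℝ E) (i : ι) {f : E → ℝ}
    (hf : ∀ (t : ℝ) (y : E), f (y + t • b i) = f y) (y : E) : pd b i f y = 0 := by
  by_cases h : DifferentiableAt ℝ f y
  · rw [pd, ← h.lineDeriv_eq_fderiv, lineDeriv]
    simp [hf]
  -- Where `f` is not differentiable, `fderiv` takes its default value zero, so no smoothness has to
  -- be assumed.
  · simp [pd, fderiv_zero_of_not_differentiableAt h]

theorem pd_invariant (b : Module.Basis ι ℝ E) (i j : ι) {f : E → ℝ}
    (hf : ∀ (t : ℝ) (y : E), f (y + t • b i) = f y) (t : ℝ) (y : E) :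
    pd b j f (y + t • b i) = pd b j f y := by
  rw [pd, ← fderiv_comp_add_right]
  simp [pd, hf]

variable [Fintype ι] [DecidableEq ι]

theorem christoffel_congr {b : Module.Basis ι ℝ E} {G G' : E → Matrix ι ι ℝ} {y : E}
    (h : G =ᶠ[𝓝 y] G') (k i j : ι) : christoffel b G k i j y = christoffel b G' k i j y := by
  have h' : ∀ i j, (fun z => G z i j) =ᶠ[𝓝 y] fun z => G' z i j := fun i j => by
    filter_upwards [h] with z hz
    rw [hz]
  simp only [christoffel, h.eq_of_nhds, pd_congr (h' _ _)]

/-- Equality of germs rather than of values, because the Ricci tensor differentiates the Christoffel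
symbols once more. -/
theorem christoffel_eventuallyEq {b : Module.Basis ι ℝ E} {G G' : E → Matrix ι ι ℝ} {y : E}
    (h : G =ᶠ[𝓝 y] G') (k i j : ι) : christoffel b G k i j =ᶠ[𝓝 y] christoffel b G' k i j := by
  filter_upwards [h.eventuallyEq_nhds] with z hz using christoffel_congr hz k i j

theorem ricciCoord_congr {b : Module.Basis ι ℝ E} {G G' : E → Matrix ι ι ℝ} {y : E}
    (h : G =ᶠ[𝓝 y] G') (i j : ι) : ricciCoord b G i j y = ricciCoord b G' i j y := by
  simp only [ricciCoord, pd_congr (christoffel_eventuallyEq h _ _ _), christoffel_congr h]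

theorem hessCoord_congr {b : Module.Basis ι ℝ E} {G G' : E → Matrix ι ι ℝ} {y : E}
    (h : G =ᶠ[𝓝 y] G') (f : E → ℝ) (i j : ι) :
    hessCoord b G f i j y = hessCoord b G' f i j y := by
  simp only [hessCoord, christoffel_congr h]

/-- The inverse of the matrix with entries `c dᵢ dⱼ Gᵢⱼ`. -/
theorem inv_diagonal_conj {c : ℝ} (hc : c ≠ 0) {d : ι → ℝ} (hd : ∀ i, d i ≠ 0)
    (G G' : Matrix ι ι ℝ) (h : ∀ i j, G' i j = c * (d i * d j) * G i j) (k l : ι) :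
    G'⁻¹ k l = c⁻¹ * ((d k)⁻¹ * (d l)⁻¹) * G⁻¹ k l := by
  have h1 : G' = Matrix.diagonal (fun i => c * d i) * G * Matrix.diagonal d := by
    ext i j
    simp only [Matrix.diagonal_mul, Matrix.mul_diagonal, h]
    ring
  have h2 : (Matrix.diagonal d)⁻¹ = Matrix.diagonal (fun i => (d i)⁻¹) :=
    Matrix.inv_eq_right_inv (by simp [Matrix.diagonal_mul_diagonal, hd])
  have h3 : (Matrix.diagonal (fun i => c * d i))⁻¹ = Matrix.diagonal (fun i => (c * d i)⁻¹) :=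
    Matrix.inv_eq_right_inv (by
      simp only [Matrix.diagonal_mul_diagonal]
      rw [← Matrix.diagonal_one]
      congr 1
      ext i
      exact mul_inv_cancel₀ (mul_ne_zero hc (hd i)))
  rw [h1, Matrix.mul_inv_rev, Matrix.mul_inv_rev, h2, h3, ← mul_assoc]
  simp only [Matrix.diagonal_mul, Matrix.mul_diagonal]
  rw [mul_inv]
  ring

/-! ### Behaviour under a homothety composed with a linear map diagonal in the basis. -/

section Scaling

variable {b : Module.Basis ι ℝ E} {L : E ≃L[ℝ] E} {d : ι → ℝ} {c : ℝ} {G G' : E → Matrix ι ι ℝ}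

/-- The constant `c` cancels between the inverse metric and its first derivatives; only the weights
`d` of the diagonal map survive, one per lower index and an inverse one for the upper index. -/
theorem christoffel_scale (hL : ∀ i, L (b i) = d i • b i) (hc : c ≠ 0) (hd : ∀ i, d i ≠ 0)
    (h : ∀ y i j, G' y i j = c * (d i * d j) * G (L y) i j) (k i j : ι) (y : E) :
    christoffel b G' k i j y = (d i * d j * (d k)⁻¹) * christoffel b G k i j (L y) := by
  have hp : ∀ m i j, pd b m (fun z => G' z i j) y =
      c * (d i * d j) * (d m * pd b m (fun z => G z i j) (L y)) := fun m i j => by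
    simp only [h, pd_const_mul]
    rw [pd_comp_equiv b hL m (fun z => G z i j)]
  simp only [christoffel, hp, inv_diagonal_conj hc hd (G (L y)) (G' y) (h y)]
  simp only [Finset.mul_sum]
  refine Finset.sum_congr rfl fun l _ => ?_
  have := hd l
  have := hd k
  field_simp

/-- In each term the contracted indices contribute `d k` and `(d k)⁻¹`, which cancel. The free
indices leave `d i * d j`, and there is no trace of `c`. -/
theorem ricciCoord_scale (hL : ∀ i, L (b i) = d i • b i) (hc : c ≠ 0) (hd : ∀ i, d i ≠ 0)
    (h : ∀ y i j, G' y i j = c * (d i * d j) * G (L y) i j) (i j : ι) (y : E) :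
    ricciCoord b G' i j y = d i * d j * ricciCoord b G i j (L y) := by
  have hp : ∀ m k i j, pd b m (christoffel b G' k i j) y =
      (d i * d j * (d k)⁻¹) * (d m * pd b m (christoffel b G k i j) (L y)) := fun m k i j => by
    rw [show christoffel b G' k i j = _ from funext (christoffel_scale hL hc hd h k i j),
      pd_const_mul, pd_comp_equiv b hL m (christoffel b G k i j)]
  simp only [ricciCoord, hp, christoffel_scale hL hc hd h, mul_add, mul_sub, Finset.mul_sum]
  congr 2
  · refine Finset.sum_congr rfl fun k _ => ?_
    have := hd k
    field_simp
  · refine Finset.sum_congr rfl fun k _ => ?_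
    have := hd k
    field_simp
  · ext k
    refine Finset.sum_congr rfl fun l _ => ?_
    have := hd k
    have := hd l
    field_simp

theorem hessCoord_scale (hL : ∀ i, L (b i) = d i • b i) (hc : c ≠ 0) (hd : ∀ i, d i ≠ 0)
    (h : ∀ y i j, G' y i j = c * (d i * d j) * G (L y) i j) (f : E → ℝ) (i j : ι) (y : E) :
    hessCoord b G' (fun z => f (L z)) i j y = d i * d j * hessCoord b G f i j (L y) := by
  have hp : pd b j (fun z => f (L z)) = fun y => d j * pd b j f (L y) :=
    funext (pd_comp_equiv b hL j f)
  simp only [hessCoord, hp, pd_const_mul, pd_comp_equiv b hL i (pd b j f), pd_comp_equiv b hL _ f,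
    christoffel_scale hL hc hd h, mul_sub, Finset.mul_sum]
  congr 1
  · ring
  · refine Finset.sum_congr rfl fun k _ => ?_
    have := hd k
    field_simp

end Scaling

/-! ### Smoothness of the inverse metric and of the Christoffel symbols. -/

section Smooth

variable {U : Set E}

theorem contDiffOn_det {G : E → Matrix ι ι ℝ}
    (hG : ∀ i j, ContDiffOn ℝ ∞ (fun y => G y i j) U) :
    ContDiffOn ℝ ∞ (fun y => (G y).det) U := by
  simp only [Matrix.det_apply']
  exact ContDiffOn.sum fun σ _ => contDiffOn_const.mul (contDiffOn_prod fun i _ => hG _ _)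

/-- By Cramer's rule the entries of the inverse are quotients of determinants, which are polynomial
in the entries. -/
theorem contDiffOn_inv {G : E → Matrix ι ι ℝ}
    (hG : ∀ i j, ContDiffOn ℝ ∞ (fun y => G y i j) U) (hdet : ∀ y ∈ U, IsUnit (G y).det) (k l : ι) :
    ContDiffOn ℝ ∞ (fun y => (G y)⁻¹ k l) U := by
  simp only [Matrix.inv_def, Matrix.smul_apply, Ring.inverse_eq_inv', smul_eq_mul,
    Matrix.adjugate_apply]
  refine ((contDiffOn_det hG).inv fun y hy => (hdet y hy).ne_zero).mul
    (contDiffOn_det fun i j => ?_)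
  by_cases h : i = l
  · subst h
    simpa using contDiffOn_const
  · simpa [Matrix.updateRow_ne h] using hG i j

theorem contDiffOn_christoffel (b : Module.Basis ι ℝ E) {G : E → Matrix ι ι ℝ} (hU : IsOpen U)
    (hG : ∀ i j, ContDiffOn ℝ ∞ (fun y => G y i j) U) (hdet : ∀ y ∈ U, IsUnit (G y).det)
    (k i j : ι) : ContDiffOn ℝ ∞ (christoffel b G k i j) U :=
  contDiffOn_const.mul (ContDiffOn.sum fun l _ => (contDiffOn_inv hG hdet k l).mul
    (((contDiffOn_pd b i hU (hG j l)).add (contDiffOn_pd b j hU (hG i l))).sub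
      (contDiffOn_pd b l hU (hG i j))))

end Smooth

end Coordinates

/-! ### Metrics `2 du dv + g_u` in coordinates -/

section NormalForm

variable {n : ℕ}

/-- The matrix of `2 du dv + g` in the basis `∂_v, ∂_i, ∂_u`. -/
def normalMatrix (g : Matrix (Fin n) (Fin n) ℝ) :
    Matrix (Unit ⊕ (Fin n ⊕ Unit)) (Unit ⊕ (Fin n ⊕ Unit)) ℝ
  | .inl _, .inr (.inr _) => 1
  | .inr (.inr _), .inl _ => 1
  | .inr (.inl i), .inr (.inl j) => g i j
  | _, _ => 0

section Entries

variable (g : Matrix (Fin n) (Fin n) ℝ) (i j : Fin n) (a b : Unit)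

@[simp] theorem normalMatrix_vv : normalMatrix g (.inl a) (.inl b) = 0 := rfl
@[simp] theorem normalMatrix_vx : normalMatrix g (.inl a) (.inr (.inl j)) = 0 := rfl
@[simp] theorem normalMatrix_vu : normalMatrix g (.inl a) (.inr (.inr b)) = 1 := rfl
@[simp] theorem normalMatrix_xv : normalMatrix g (.inr (.inl i)) (.inl b) = 0 := rfl
@[simp] theorem normalMatrix_xx : normalMatrix g (.inr (.inl i)) (.inr (.inl j)) = g i j := rfl
@[simp] theorem normalMatrix_xu : normalMatrix g (.inr (.inl i)) (.inr (.inr b)) = 0 := rfl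
@[simp] theorem normalMatrix_uv : normalMatrix g (.inr (.inr a)) (.inl b) = 1 := rfl
@[simp] theorem normalMatrix_ux : normalMatrix g (.inr (.inr a)) (.inr (.inl j)) = 0 := rfl
@[simp] theorem normalMatrix_uu : normalMatrix g (.inr (.inr a)) (.inr (.inr b)) = 0 := rfl

end Entries

/-- The `u, v` block is a swap and is its own inverse, so inverting the normal form amounts to
inverting `g`. -/
theorem normalMatrix_mul (g h : Matrix (Fin n) (Fin n) ℝ) (hgh : g * h = 1) :
    normalMatrix g * normalMatrix h = 1 := by
  ext I J
  rcases I with I | I | I <;> rcases J with J | J | J <;>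
    simp [Matrix.mul_apply, Fintype.sum_sum_type, Matrix.one_apply]
  have := congrFun (congrFun hgh I) J
  simpa [Matrix.mul_apply, Matrix.one_apply] using this

theorem normalMatrix_inv {g : Matrix (Fin n) (Fin n) ℝ} (hg : IsUnit g.det) :
    (normalMatrix g)⁻¹ = normalMatrix g⁻¹ :=
  Matrix.inv_eq_right_inv (normalMatrix_mul _ _ (Matrix.mul_nonsing_inv _ hg))

theorem isUnit_det_normalMatrix {g : Matrix (Fin n) (Fin n) ℝ} (hg : IsUnit g.det) :
    IsUnit (normalMatrix g).det :=
  Matrix.isUnit_det_of_right_inverse (normalMatrix_mul _ _ (Matrix.mul_nonsing_inv _ hg))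

/-- The component matrix of `2 du dv + g_u` as a function of `(v, x, u)`. -/
def normalField (g : ℝ → EuclideanSpace ℝ (Fin n) → Matrix (Fin n) (Fin n) ℝ)
    (y : ℝ × EuclideanSpace ℝ (Fin n) × ℝ) :
    Matrix (Unit ⊕ (Fin n ⊕ Unit)) (Unit ⊕ (Fin n ⊕ Unit)) ℝ :=
  normalMatrix (g y.2.2 y.2.1)

@[simp] theorem ambBasis_v (a : Unit) : ambBasis n (.inl a) = (1, 0, 0) := by
  simp [ambBasis]
  rfl

@[simp] theorem ambBasis_x (i : Fin n) : ambBasis n (.inr (.inl i)) = (0, baseBasis n i, 0) := by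
  simp [ambBasis]

@[simp] theorem ambBasis_u (a : Unit) : ambBasis n (.inr (.inr a)) = (0, 0, 1) := by
  simp [ambBasis]

/-- Along the leaves of constant `v, u`, ambient derivatives are derivatives on the leaf. -/
theorem pd_x {F : ℝ × EuclideanSpace ℝ (Fin n) × ℝ → ℝ} {y : ℝ × EuclideanSpace ℝ (Fin n) × ℝ}
    (hF : DifferentiableAt ℝ F y) (i : Fin n) :
    pd (ambBasis n) (.inr (.inl i)) F y =
      pd (baseBasis n) i (fun x => F (y.1, x, y.2.2)) y.2.1 := by
  have h1 : HasFDerivAt (fun x : EuclideanSpace ℝ (Fin n) => (y.1, x, y.2.2))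
      ((0 : EuclideanSpace ℝ (Fin n) →L[ℝ] ℝ).prod
        ((ContinuousLinearMap.id ℝ (EuclideanSpace ℝ (Fin n))).prod 0)) y.2.1 :=
    (hasFDerivAt_const _ _).prodMk ((hasFDerivAt_id _).prodMk (hasFDerivAt_const _ _))
  have h2 : HasFDerivAt F (fderiv ℝ F y) (y.1, y.2.1, y.2.2) := hF.hasFDerivAt
  have h3 := h2.comp y.2.1 h1
  have h4 : (F ∘ fun x : EuclideanSpace ℝ (Fin n) => (y.1, x, y.2.2)) =
      fun x => F (y.1, x, y.2.2) := rfl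
  rw [h4] at h3
  simp [pd, h3.fderiv]

theorem eventually_leaf {U : Set (ℝ × EuclideanSpace ℝ (Fin n) × ℝ)} (hU : IsOpen U)
    {y : ℝ × EuclideanSpace ℝ (Fin n) × ℝ} (hy : y ∈ U) :
    ∀ᶠ x in 𝓝 y.2.1, (y.1, x, y.2.2) ∈ U :=
  (show Continuous fun x : EuclideanSpace ℝ (Fin n) => (y.1, x, y.2.2) by fun_prop).continuousAt
    |>.eventually_mem (hU.mem_nhds hy)

theorem pd_const {ι E : Type*} [NormedAddCommGroup E] [NormedSpace ℝ E] (b : Module.Basis ι ℝ E)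
    (i : ι) (c : ℝ) (y : E) : pd b i (fun _ => c) y = 0 := by
  simp [pd]

variable {g : ℝ → EuclideanSpace ℝ (Fin n) → Matrix (Fin n) (Fin n) ℝ}

theorem pd_v_eq_zero {F : ℝ × EuclideanSpace ℝ (Fin n) × ℝ → ℝ}
    (hF : ∀ v w x u, F (v, x, u) = F (w, x, u)) (a : Unit)
    (y : ℝ × EuclideanSpace ℝ (Fin n) × ℝ) : pd (ambBasis n) (.inl a) F y = 0 :=
  pd_eq_zero_of_invariant _ _ (fun t y => by
    obtain ⟨v, x, u⟩ := y
    simpa using hF _ _ _ _) y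

/-! ### Christoffel symbols of the normal form. -/

section Christoffel

variable {y : ℝ × EuclideanSpace ℝ (Fin n) × ℝ}

/-- The only nonzero entry in the `u` row of the inverse is the one with `v`. What remains are
derivatives of the constant entries `g_{vJ}`, `g_{Iv}`, and `∂_v` of entries independent of `v`. -/
theorem christoffel_normal_upper_u (hdet : IsUnit (g y.2.2 y.2.1).det) (a : Unit)
    (I J : Unit ⊕ (Fin n ⊕ Unit)) :
    christoffel (ambBasis n) (normalField g) (.inr (.inr a)) I J y = 0 := by
  rcases I with I | I | I <;> rcases J with J | J | J <;>
    simp [christoffel, normalField, normalMatrix_inv hdet, Fintype.sum_sum_type, pd_const]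
  exact pd_v_eq_zero (fun _ _ _ _ => rfl) _ _

/-- This says that `∂_v` is parallel: it preserves the metric, and its pairings with coordinate
fields are constant. -/
theorem christoffel_normal_lower_v_right (hdet : IsUnit (g y.2.2 y.2.1).det) (a : Unit)
    (K I : Unit ⊕ (Fin n ⊕ Unit)) :
    christoffel (ambBasis n) (normalField g) K I (.inl a) y = 0 := by
  rcases K with K | K | K <;> rcases I with I | I | I <;>
    simp [christoffel, normalField, normalMatrix_inv hdet, Fintype.sum_sum_type, pd_const]
  exact Finset.sum_eq_zero fun l _ => by
    rw [pd_v_eq_zero (fun _ _ _ _ => rfl), mul_zero]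

theorem christoffel_normal_lower_v_left (hdet : IsUnit (g y.2.2 y.2.1).det) (a : Unit)
    (K J : Unit ⊕ (Fin n ⊕ Unit)) :
    christoffel (ambBasis n) (normalField g) K (.inl a) J y = 0 := by
  rcases K with K | K | K <;> rcases J with J | J | J <;>
    simp [christoffel, normalField, normalMatrix_inv hdet, Fintype.sum_sum_type, pd_const]
  exact Finset.sum_eq_zero fun l _ => by
    rw [pd_v_eq_zero (fun _ _ _ _ => rfl), mul_zero]

/-- Raising with `g^{vu} = 1` leaves only `-½ ∂_u gᵢⱼ`, since `g_{iu} = 0`. This symbol is the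
source of the `u`-derivative of the metric in the leaf equations. -/
theorem christoffel_normal_vxx (hdet : IsUnit (g y.2.2 y.2.1).det) (a : Unit) (i j : Fin n) :
    christoffel (ambBasis n) (normalField g) (.inl a) (.inr (.inl i)) (.inr (.inl j)) y =
      -(1 / 2) * pd (ambBasis n) (.inr (.inr a)) (fun z => g z.2.2 z.2.1 i j) y := by
  simp [christoffel, normalField, normalMatrix_inv hdet, Fintype.sum_sum_type, pd_const]

theorem christoffel_normal_xxx (hdet : IsUnit (g y.2.2 y.2.1).det)
    (hg : ∀ i j, DifferentiableAt ℝ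
      (fun z : ℝ × EuclideanSpace ℝ (Fin n) × ℝ => g z.2.2 z.2.1 i j) y) (k i j : Fin n) :
    christoffel (ambBasis n) (normalField g) (.inr (.inl k)) (.inr (.inl i)) (.inr (.inl j)) y =
      christoffel (baseBasis n) (g y.2.2) k i j y.2.1 := by
  simp [christoffel, normalField, normalMatrix_inv hdet, Fintype.sum_sum_type, pd_x (hg _ _)]

theorem christoffel_normal_invariant (K I J : Unit ⊕ (Fin n ⊕ Unit)) (v w : ℝ)
    (x : EuclideanSpace ℝ (Fin n)) (u : ℝ) :
    christoffel (ambBasis n) (normalField g) K I J (v, x, u) =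
      christoffel (ambBasis n) (normalField g) K I J (w, x, u) := by
  have h : ∀ I J m, pd (ambBasis n) m (fun z => normalField g z I J) (v, x, u) =
      pd (ambBasis n) m (fun z => normalField g z I J) (w, x, u) := fun I J m => by
    have := pd_invariant (ambBasis n) (.inl ()) m (f := fun z => normalField g z I J)
      (fun t z => by simp [normalField]) (v - w) (w, x, u)
    simpa using this
  simp only [christoffel, h]
  rfl

end Christoffel

/-! ### Ambient Ricci tensor, Hessian and traces in terms of the leaves. -/

section Curvature

variable {U : Set (ℝ × EuclideanSpace ℝ (Fin n) × ℝ)} {y : ℝ × EuclideanSpace ℝ (Fin n) × ℝ}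

theorem contDiffOn_normalField
    (hg : ∀ i j, ContDiffOn ℝ ∞ (fun z => g z.2.2 z.2.1 i j) U)
    (I J : Unit ⊕ (Fin n ⊕ Unit)) : ContDiffOn ℝ ∞ (fun z => normalField g z I J) U := by
  rcases I with I | I | I <;> rcases J with J | J | J <;>
    simp [normalField, contDiffOn_const, hg]

theorem differentiableAt_of_contDiffOn {E : Type*} [NormedAddCommGroup E] [NormedSpace ℝ E]
    {S : Set E} {F : E → ℝ} (hS : IsOpen S) (hF : ContDiffOn ℝ ∞ F S) {z : E} (hz : z ∈ S) :
    DifferentiableAt ℝ F z :=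
  (hF.contDiffAt (hS.mem_nhds hz)).differentiableAt (by simp)

/-- There is no extrinsic correction. A contraction over `v` or `u` involves a lower `v` or an upper
`u` and so vanishes, except for `∂_v Γᵛᵢⱼ`, which vanishes because the symbols do not depend on `v`.
-/
theorem ricciCoord_normal (hU : IsOpen U)
    (hg : ∀ i j, ContDiffOn ℝ ∞ (fun z => g z.2.2 z.2.1 i j) U)
    (hdet : ∀ z ∈ U, IsUnit (g z.2.2 z.2.1).det) (hy : y ∈ U) (i j : Fin n) :
    ricciCoord (ambBasis n) (normalField g) (.inr (.inl i)) (.inr (.inl j)) y =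
      ricciCoord (baseBasis n) (g y.2.2) i j y.2.1 := by
  have hd : ∀ z ∈ U, ∀ i j, DifferentiableAt ℝ
      (fun z : ℝ × EuclideanSpace ℝ (Fin n) × ℝ => g z.2.2 z.2.1 i j) z := fun z hz i j =>
    differentiableAt_of_contDiffOn hU (hg i j) hz
  have hxxx : ∀ m k i j, pd (ambBasis n) (.inr (.inl m))
      (christoffel (ambBasis n) (normalField g) (.inr (.inl k)) (.inr (.inl i)) (.inr (.inl j))) y =
      pd (baseBasis n) m (christoffel (baseBasis n) (g y.2.2) k i j) y.2.1 := fun m k i j => by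
    rw [pd_x (differentiableAt_of_contDiffOn hU (contDiffOn_christoffel _ hU
      (contDiffOn_normalField hg) (fun z hz => isUnit_det_normalMatrix (hdet z hz)) _ _ _) hy)]
    refine pd_congr ?_ _
    filter_upwards [eventually_leaf hU hy] with x hx
    rw [christoffel_normal_xxx (hdet _ hx) (hd _ hx)]
  have hzero : ∀ m K I J, (∀ z ∈ U, christoffel (ambBasis n) (normalField g) K I J z = 0) →
      pd (ambBasis n) m (christoffel (ambBasis n) (normalField g) K I J) y = 0 :=
    fun m K I J h => by
      rw [pd_congr (g := fun _ => 0), pd_const]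
      filter_upwards [hU.mem_nhds hy] with z hz using h z hz
  have hv : ∀ K I J a, pd (ambBasis n) (.inl a)
      (christoffel (ambBasis n) (normalField g) K I J) y = 0 := fun K I J a =>
    pd_v_eq_zero (fun _ _ _ _ => christoffel_normal_invariant _ _ _ _ _ _ _) _ _
  have hu : ∀ m I J a, pd (ambBasis n) m
      (christoffel (ambBasis n) (normalField g) (.inr (.inr a)) I J) y = 0 := fun m I J a =>
    hzero _ _ _ _ fun z hz => christoffel_normal_upper_u (hdet z hz) _ _ _
  have hr : ∀ m K I a, pd (ambBasis n) m
      (christoffel (ambBasis n) (normalField g) K I (.inl a)) y = 0 := fun m K I a =>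
    hzero _ _ _ _ fun z hz => christoffel_normal_lower_v_right (hdet z hz) _ _ _
  simp [ricciCoord, Fintype.sum_sum_type, hxxx, hv, hu, hr,
    christoffel_normal_upper_u (hdet y hy), christoffel_normal_lower_v_right (hdet y hy),
    christoffel_normal_lower_v_left (hdet y hy), christoffel_normal_xxx (hdet y hy) (hd y hy)]

variable {f : ℝ × EuclideanSpace ℝ (Fin n) × ℝ → ℝ}

/-- The extra term is `-Γᵛᵢⱼ ∂_v f`; the symbols with upper index `u` contribute nothing. -/
theorem hessCoord_normal_xx (hU : IsOpen U)
    (hg : ∀ i j, ContDiffOn ℝ ∞ (fun z => g z.2.2 z.2.1 i j) U)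
    (hdet : ∀ z ∈ U, IsUnit (g z.2.2 z.2.1).det) (hf : ContDiffOn ℝ ∞ f U) (hy : y ∈ U)
    (i j : Fin n) :
    hessCoord (ambBasis n) (normalField g) f (.inr (.inl i)) (.inr (.inl j)) y =
      hessCoord (baseBasis n) (g y.2.2) (fun x => f (y.1, x, y.2.2)) i j y.2.1 +
        1 / 2 * pd (ambBasis n) (.inr (.inr ())) (fun z => g z.2.2 z.2.1 i j) y *
          pd (ambBasis n) (.inl ()) f y := by
  have h2 : pd (ambBasis n) (.inr (.inl i)) (pd (ambBasis n) (.inr (.inl j)) f) y =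
      pd (baseBasis n) i (pd (baseBasis n) j fun x => f (y.1, x, y.2.2)) y.2.1 := by
    rw [pd_x (differentiableAt_of_contDiffOn hU (contDiffOn_pd _ _ hU hf) hy)]
    refine pd_congr ?_ _
    filter_upwards [eventually_leaf hU hy] with x hx
    rw [pd_x (differentiableAt_of_contDiffOn hU hf hx)]
  simp [hessCoord, Fintype.sum_sum_type, h2, christoffel_normal_upper_u (hdet y hy),
    christoffel_normal_vxx (hdet y hy), pd_x (differentiableAt_of_contDiffOn hU hf hy),
    christoffel_normal_xxx (hdet y hy)
      (fun i j => differentiableAt_of_contDiffOn hU (hg i j) hy)]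
  ring

/-- Off the leaf block, the inverse metric only pairs `u` with `v`. The symbols with a lower `v`
vanish, so both mixed Hessian entries are plain second derivatives. -/
theorem trace_hessCoord_normal (hU : IsOpen U)
    (hg : ∀ i j, ContDiffOn ℝ ∞ (fun z => g z.2.2 z.2.1 i j) U)
    (hdet : ∀ z ∈ U, IsUnit (g z.2.2 z.2.1).det) (hf : ContDiffOn ℝ ∞ f U) (hy : y ∈ U) :
    ∑ I, ∑ J, (normalField g y)⁻¹ I J * hessCoord (ambBasis n) (normalField g) f I J y =
      ∑ i, ∑ j, (g y.2.2 y.2.1)⁻¹ i j *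
        (hessCoord (baseBasis n) (g y.2.2) (fun x => f (y.1, x, y.2.2)) i j y.2.1 +
        1 / 2 * pd (ambBasis n) (.inr (.inr ())) (fun z => g z.2.2 z.2.1 i j) y *
          pd (ambBasis n) (.inl ()) f y) +
      2 * pd (ambBasis n) (.inr (.inr ())) (pd (ambBasis n) (.inl ()) f) y := by
  have huv : hessCoord (ambBasis n) (normalField g) f (.inr (.inr ())) (.inl ()) y =
      pd (ambBasis n) (.inr (.inr ())) (pd (ambBasis n) (.inl ()) f) y := by
    simp [hessCoord, christoffel_normal_lower_v_right (hdet y hy)]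
  have hvu : hessCoord (ambBasis n) (normalField g) f (.inl ()) (.inr (.inr ())) y =
      pd (ambBasis n) (.inr (.inr ())) (pd (ambBasis n) (.inl ()) f) y := by
    rw [pd_comm _ _ _ (hf.contDiffAt (hU.mem_nhds hy))]
    simp [hessCoord, christoffel_normal_lower_v_left (hdet y hy)]
  simp only [← hessCoord_normal_xx hU hg hdet hf hy]
  have hinv : (normalField g y)⁻¹ = normalMatrix (g y.2.2 y.2.1)⁻¹ := normalMatrix_inv (hdet y hy)
  simp [hinv, Fintype.sum_sum_type, huv, hvu]
  ring

theorem gradSq_normal (hdet : IsUnit (g y.2.2 y.2.1).det) (hf : DifferentiableAt ℝ f y) :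
    ∑ I, ∑ J, (normalField g y)⁻¹ I J * pd (ambBasis n) I f y * pd (ambBasis n) J f y =
      ∑ i, ∑ j, (g y.2.2 y.2.1)⁻¹ i j *
        pd (baseBasis n) i (fun x => f (y.1, x, y.2.2)) y.2.1 *
        pd (baseBasis n) j (fun x => f (y.1, x, y.2.2)) y.2.1 +
      2 * pd (ambBasis n) (.inr (.inr ())) f y * pd (ambBasis n) (.inl ()) f y := by
  simp [normalField, normalMatrix_inv hdet, Fintype.sum_sum_type, pd_x hf]
  ring

end Curvature

end NormalForm

/-! ### Tensors in charts -/

section Charts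

variable {ι E H N : Type*} [NormedAddCommGroup E] [NormedSpace ℝ E]
  [TopologicalSpace H] [TopologicalSpace N] [ChartedSpace H N]

theorem evalComponents_basis [Fintype ι] (I : ModelWithCorners ℝ E H) (b : Module.Basis ι ℝ E)
    (p : N) (c : ι → ι → ℝ) (i j : ι) : evalComponents I b p c (b i : E) (b j : E) = c i j := by
  classical
  simp [evalComponents, Finsupp.single_apply]

/-- The base point is a separate variable `q`, so that `D` can be computed in a convenient form
before the dependent tangent space at `q` is involved. -/
theorem coordTensor_apply (I : ModelWithCorners ℝ E H) (b : Module.Basis ι ℝ E)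
    (h : TwoTensor I N) {p q : N} {y : E} (hq : (extChartAt I p).symm y = q) {D : E →L[ℝ] E}
    (hD : HasFDerivAt (fun z => extChartAt I q ((extChartAt I p).symm z)) D y) (i j : ι) :
    coordTensor I b h p y i j = h q (D (b i) : E) (D (b j) : E) := by
  subst hq
  rw [← hD.fderiv]
  rfl

theorem coordField_apply (I : ModelWithCorners ℝ E H) (b : Module.Basis ι ℝ E)
    (Y : (q : N) → TangentSpace I q) {p q : N} {y : E} (hq : (extChartAt I p).symm y = q)
    {D : E →L[ℝ] E}
    (hD : HasFDerivAt (fun z => extChartAt I p ((extChartAt I q).symm z)) D (extChartAt I q q))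
    (k : ι) :
    coordField I b Y p k y = b.repr (D (Y q : E)) k := by
  subst hq
  rw [← hD.fderiv]
  rfl

theorem hasFDerivAt_coordChange (I : ModelWithCorners ℝ E H) [I.Boundaryless] [IsManifold I 1 N]
    {p q : N} {y : E} (hy : y ∈ (extChartAt I p).target)
    (hq : (extChartAt I p).symm y ∈ (extChartAt I q).source) :
    HasFDerivAt (fun z => extChartAt I q ((extChartAt I p).symm z))
      (tangentCoordChange I p q ((extChartAt I p).symm y)) y := by
  have := hasFDerivWithinAt_tangentCoordChange (I := I) (x := p) (y := q)
    (z := (extChartAt I p).symm y) ⟨(extChartAt I p).map_target hy, hq⟩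
  rw [I.range_eq_univ, hasFDerivWithinAt_univ, (extChartAt I p).right_inv hy] at this
  exact this

/-- At the centre of its own chart a tensor or vector field has its literal components, with no
Jacobian. -/
theorem hasFDerivAt_chart_self (I : ModelWithCorners ℝ E H) [I.Boundaryless] (p : N) :
    HasFDerivAt (fun z => extChartAt I p ((extChartAt I p).symm z)) (ContinuousLinearMap.id ℝ E)
      (extChartAt I p p) :=
  (hasFDerivAt_id _).congr_of_eventuallyEq <| by
    filter_upwards [(isOpen_extChartAt_target p).mem_nhds (mem_extChartAt_target p)] with z hz
    exact (extChartAt I p).right_inv hz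

theorem coordTensor_self (I : ModelWithCorners ℝ E H) [I.Boundaryless] (b : Module.Basis ι ℝ E)
    (h : TwoTensor I N) (p : N) (i j : ι) :
    coordTensor I b h p (extChartAt I p p) i j = h p (b i : E) (b j : E) := by
  rw [coordTensor_apply I b h (extChartAt_to_inv p) (hasFDerivAt_chart_self I p)]
  rfl

/-- The component matrix of a positive definite form is invertible. -/
theorem isUnit_det_coordTensor [Fintype ι] [DecidableEq ι] (I : ModelWithCorners ℝ E H) [I.Boundaryless] [IsManifold I 1 N]
    (b : Module.Basis ι ℝ E) (h : TwoTensor I N) {p : N} {y : E}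
    (hy : y ∈ (extChartAt I p).target)
    (hpos : ∀ X : TangentSpace I ((extChartAt I p).symm y), X ≠ 0 → 0 < h _ X X) :
    IsUnit (coordTensor I b h p y).det := by
  set q := (extChartAt I p).symm y with hq
  have hqp : q ∈ (extChartAt I p).source := (extChartAt I p).map_target hy
  have hqq : q ∈ (extChartAt I q).source := mem_extChartAt_source q
  rw [isUnit_iff_ne_zero]
  intro hdet
  -- A kernel vector `c` of the matrix gives a tangent vector null for `h`. Positivity forces it to
  -- vanish, and then `c = 0` because the coordinate change `T` has a left inverse.
  obtain ⟨c, hc, hc0⟩ := Matrix.exists_vecMul_eq_zero_iff.mpr hdet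
  set T := tangentCoordChange I p q q
  let h' : LinearMap.BilinForm ℝ E := h q
  have hG : ∀ i j, coordTensor I b h p y i j = h' (T (b i)) (T (b j)) := fun i j =>
    coordTensor_apply I b h hq.symm (hasFDerivAt_coordChange I hy hqq) i j
  have hX : h' (T (∑ i, c i • b i)) (T (∑ i, c i • b i)) = 0 := by
    have hi : ∀ j, ∑ i, c i * h' (T (b i)) (T (b j)) = 0 := fun j => by
      simpa only [Matrix.vecMul, dotProduct, hG, Pi.zero_apply] using congrFun hc0 j
    simp only [map_sum, map_smul, LinearMap.sum_apply, LinearMap.smul_apply, smul_eq_mul, hi,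
      mul_zero, Finset.sum_const_zero]
  have hT : T (∑ i, c i • b i) = 0 := by
    by_contra hne
    exact (hpos _ hne).ne' hX
  have h0 : ∑ i, c i • b i = 0 := by
    have := tangentCoordChange_comp (I := I) (w := p) (x := q) (y := p) (z := q)
      (v := ∑ i, c i • b i) ⟨⟨hqp, hqq⟩, hqp⟩
    rw [tangentCoordChange_self hqp] at this
    rw [← this]
    change tangentCoordChange I q p q (T (∑ i, c i • b i)) = 0
    rw [hT, map_zero]
  exact hc (funext (Fintype.linearIndependent_iff.mp b.linearIndependent c h0))

end Charts

/-! ### Normal spaces in the product charts of `ℝ × M × ℝ`. -/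

namespace NormalSpace

variable {n : ℕ} {M : Type*} [TopologicalSpace M] [ChartedSpace (EuclideanSpace ℝ (Fin n)) M]

theorem extChartAt_amb_symm (p : ℝ × M × ℝ) (y : ℝ × EuclideanSpace ℝ (Fin n) × ℝ) :
    (extChartAt (ambI n) p).symm y = (y.1, (extChartAt (𝓡 n) p.2.1).symm y.2.1, y.2.2) := rfl

theorem extChartAt_amb (p q : ℝ × M × ℝ) :
    extChartAt (ambI n) p q = (q.1, extChartAt (𝓡 n) p.2.1 q.2.1, q.2.2) := rfl

theorem mem_extChartAt_amb_target {p : ℝ × M × ℝ} {y : ℝ × EuclideanSpace ℝ (Fin n) × ℝ} :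
    y ∈ (extChartAt (ambI n) p).target ↔ y.2.1 ∈ (extChartAt (𝓡 n) p.2.1).target := by
  rw [extChartAt_prod, extChartAt_prod, extChartAt_model_space_eq_id, extChartAt_model_space_eq_id]
  simp only [PartialEquiv.prod_target, PartialEquiv.refl_target, Set.mem_prod, Set.mem_univ,
    true_and, and_true]

/-- The form `g_u` at `x`, on the model space. -/
def leafForm (A : NormalSpace n M) (u : ℝ) (x : M) :
    LinearMap.BilinForm ℝ (EuclideanSpace ℝ (Fin n)) :=
  A.metric u x

theorem ambMetric_apply (A : NormalSpace n M) (p : ℝ × M × ℝ)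
    (X Y : ℝ × EuclideanSpace ℝ (Fin n) × ℝ) :
    A.ambMetric p X Y = X.2.2 * Y.1 + X.1 * Y.2.2 + A.leafForm p.2.2 p.2.1 X.2.1 Y.2.1 := rfl

/-- The matrices of the metrics `g_u` in the chart at `x`. -/
def leafMatrix (A : NormalSpace n M) (x : M) (u : ℝ) (ξ : EuclideanSpace ℝ (Fin n)) :
    Matrix (Fin n) (Fin n) ℝ :=
  coordTensor (𝓡 n) (baseBasis n) (A.metric u) x ξ

/-- The part of the carrier over the domain of the chart at `x`, in coordinates. -/
def coordDomain (A : NormalSpace n M) (x : M) : Set (ℝ × EuclideanSpace ℝ (Fin n) × ℝ) :=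
  {y | y.2.1 ∈ (extChartAt (𝓡 n) x).target ∧
    (y.1, (extChartAt (𝓡 n) x).symm y.2.1, y.2.2) ∈ A.carrier}

/-- The charts of the two factors `ℝ` are identities, so the base values of `v` and `u` do not
matter; later uses take `(0, x, 0)`. -/
theorem coordDomain_eq (A : NormalSpace n M) (p : ℝ × M × ℝ) :
    A.coordDomain p.2.1 =
      (extChartAt (ambI n) p).target ∩ (extChartAt (ambI n) p).symm ⁻¹' A.carrier := by
  ext y
  simp only [Set.mem_inter_iff, mem_extChartAt_amb_target, Set.mem_preimage, extChartAt_amb_symm,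
    coordDomain, Set.mem_ofPred_eq]

theorem mem_coordDomain {A : NormalSpace n M} {p : ℝ × M × ℝ} (hp : p ∈ A.carrier) :
    (p.1, extChartAt (𝓡 n) p.2.1 p.2.1, p.2.2) ∈ A.coordDomain p.2.1 := by
  refine ⟨mem_extChartAt_target (I := 𝓡 n) p.2.1, ?_⟩
  simpa only [extChartAt_to_inv (I := 𝓡 n) p.2.1] using hp

section

variable (A : NormalSpace n M)

theorem hasFDerivAt_amb_coordChange {p q : ℝ × M × ℝ} {y : ℝ × EuclideanSpace ℝ (Fin n) × ℝ}
    {D : EuclideanSpace ℝ (Fin n) →L[ℝ] EuclideanSpace ℝ (Fin n)}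
    (hD : HasFDerivAt (fun z => extChartAt (𝓡 n) q.2.1 ((extChartAt (𝓡 n) p.2.1).symm z)) D y.2.1) :
    HasFDerivAt (fun z => extChartAt (ambI n) q ((extChartAt (ambI n) p).symm z))
      ((ContinuousLinearMap.id ℝ ℝ).prodMap (D.prodMap (ContinuousLinearMap.id ℝ ℝ))) y :=
  HasFDerivAt.prodMap (f := id) y (hasFDerivAt_id _)
    (HasFDerivAt.prodMap (f₂ := id) y.2 hD (hasFDerivAt_id _))

variable [IsManifold (𝓡 n) ∞ M]

/-- The component matrix of `2 du dv + g_u`. -/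
theorem coordTensor_ambMetric {p : ℝ × M × ℝ} {y : ℝ × EuclideanSpace ℝ (Fin n) × ℝ}
    (hy : y.2.1 ∈ (extChartAt (𝓡 n) p.2.1).target) :
    coordTensor (ambI n) (ambBasis n) A.ambMetric p y = normalField (A.leafMatrix p.2.1) y := by
  have : IsManifold (𝓡 n) 1 M := IsManifold.of_le (n := ∞) (by norm_cast)
  obtain ⟨D, hD⟩ : ∃ D, HasFDerivAt (fun z => extChartAt (𝓡 n)
      ((extChartAt (𝓡 n) p.2.1).symm y.2.1) ((extChartAt (𝓡 n) p.2.1).symm z)) D y.2.1 :=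
    ⟨_, hasFDerivAt_coordChange (𝓡 n) hy
      (mem_extChartAt_source ((extChartAt (𝓡 n) p.2.1).symm y.2.1))⟩
  ext I J
  rw [coordTensor_apply (ambI n) (ambBasis n) A.ambMetric (extChartAt_amb_symm p y)
    (hasFDerivAt_amb_coordChange hD)]
  rcases I with I | I | I <;> rcases J with J | J | J <;>
    rw [ambMetric_apply] <;> simp [normalField]
  exact (coordTensor_apply (𝓡 n) (baseBasis n) (A.metric y.2.2) rfl hD _ _).symm

theorem coordTensor_ambMetric_eventuallyEq (p : ℝ × M × ℝ) :
    coordTensor (ambI n) (ambBasis n) A.ambMetric p =ᶠ[𝓝 (p.1, extChartAt (𝓡 n) p.2.1 p.2.1, p.2.2)]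
      normalField (A.leafMatrix p.2.1) := by
  filter_upwards [(isOpen_extChartAt_target (I := ambI n) p).mem_nhds
    (mem_extChartAt_target (I := ambI n) p)] with y hy
  exact A.coordTensor_ambMetric (mem_extChartAt_amb_target.mp hy)

end

theorem coordFun_ambDensity (A : NormalSpace n M) (lam : ℝ) (p : ℝ × M × ℝ)
    (y : ℝ × EuclideanSpace ℝ (Fin n) × ℝ) :
    coordFun (ambI n) (A.ambDensity lam) p y =
      A.density y.2.2 ((extChartAt (𝓡 n) p.2.1).symm y.2.1) - y.1 + lam * y.2.2 * y.1 := rfl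

/-! ### The ambient equations as equations on the leaves. -/

namespace IsGlobalAmbient

variable {A : NormalSpace n M} {lam : ℝ}

theorem isOpen_coordDomain (hA : A.IsGlobalAmbient lam) (x : M) : IsOpen (A.coordDomain x) := by
  rw [A.coordDomain_eq (0, x, 0)]
  exact (continuousOn_extChartAt_symm _).isOpen_inter_preimage (isOpen_extChartAt_target _)
    hA.isOpen_carrier

variable [IsManifold (𝓡 n) ∞ M]

theorem contDiffOn_leafMatrix (hA : A.IsGlobalAmbient lam) (x : M) (i j : Fin n) :
    ContDiffOn ℝ ∞ (fun y : ℝ × EuclideanSpace ℝ (Fin n) × ℝ => A.leafMatrix x y.2.2 y.2.1 i j)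
      (A.coordDomain x) := by
  have := hA.smooth_metric (0, x, 0) (.inr (.inl i)) (.inr (.inl j))
  rw [← A.coordDomain_eq (0, x, 0)] at this
  refine this.congr fun y hy => ?_
  rw [A.coordTensor_ambMetric (p := (0, x, 0)) hy.1]
  rfl

theorem isUnit_det_leafMatrix (hA : A.IsGlobalAmbient lam) (x : M) {y : ℝ × EuclideanSpace ℝ (Fin n) × ℝ}
    (hy : y ∈ A.coordDomain x) : IsUnit (A.leafMatrix x y.2.2 y.2.1).det := by
  have : IsManifold (𝓡 n) 1 M := IsManifold.of_le (n := ∞) (by norm_cast)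
  exact isUnit_det_coordTensor (𝓡 n) (baseBasis n) (A.metric y.2.2) hy.1 (hA.pos _ hy.2)

theorem contDiffOn_coordFun (hA : A.IsGlobalAmbient lam) (p : ℝ × M × ℝ) :
    ContDiffOn ℝ ∞ (coordFun (ambI n) (A.ambDensity lam) p) (A.coordDomain p.2.1) := by
  have := (contMDiffOn_iff.mp hA.smooth_density).2 p 0
  rw [A.coordDomain_eq p]
  refine this.mono fun y hy => ⟨hy.1, hy.2, ?_⟩
  rw [extChartAt_model_space_eq_id]
  trivial

theorem pd_v_density (hA : A.IsGlobalAmbient lam) {p : ℝ × M × ℝ} {y : ℝ × EuclideanSpace ℝ (Fin n) × ℝ}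
    (hy : y ∈ A.coordDomain p.2.1) :
    pd (ambBasis n) (.inl ()) (coordFun (ambI n) (A.ambDensity lam) p) y = -(1 - lam * y.2.2) := by
  have hd := differentiableAt_of_contDiffOn (hA.isOpen_coordDomain _)
    (hA.contDiffOn_coordFun p) hy
  -- Restricted to a line in direction `∂_v`, the density is explicitly affine in the parameter, so
  -- no derivative of `φ_u` is needed.
  rw [pd, ← hd.lineDeriv_eq_fderiv]
  have h1 : HasDerivAt (fun t : ℝ => y.1 + t) 1 0 := (hasDerivAt_id 0).const_add _
  have h2 := (h1.const_sub (A.density y.2.2 ((extChartAt (𝓡 n) p.2.1).symm y.2.1))).add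
    (h1.const_mul (lam * y.2.2))
  rw [lineDeriv, show -(1 - lam * y.2.2) = -1 + lam * y.2.2 * 1 by ring, ← h2.deriv]
  congr 1
  ext t
  simp [coordFun_ambDensity]

theorem pd_u_pd_v_density (hA : A.IsGlobalAmbient lam) {p : ℝ × M × ℝ} {y : ℝ × EuclideanSpace ℝ (Fin n) × ℝ}
    (hy : y ∈ A.coordDomain p.2.1) :
    pd (ambBasis n) (.inr (.inr ()))
      (pd (ambBasis n) (.inl ()) (coordFun (ambI n) (A.ambDensity lam) p)) y = lam := by
  rw [pd_congr (g := fun z => -(1 - lam * z.2.2))]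
  · have h : HasFDerivAt (fun z : ℝ × EuclideanSpace ℝ (Fin n) × ℝ => z.2.2)
        ((ContinuousLinearMap.snd ℝ _ _).comp (ContinuousLinearMap.snd ℝ _ _)) y :=
      (hasFDerivAt_snd (p := y.2)).comp y hasFDerivAt_snd
    have h' : HasFDerivAt (fun z : ℝ × EuclideanSpace ℝ (Fin n) × ℝ => -(1 - lam * z.2.2)) _ y :=
      ((h.const_mul lam).const_sub 1).neg
    rw [pd, h'.fderiv]
    simp
  · filter_upwards [(hA.isOpen_coordDomain p.2.1).mem_nhds hy] with z hz
    exact hA.pd_v_density hz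

/-- The tangential components of `P̃ = 0`, as an equation on the leaves. -/
theorem leaf_P (hA : A.IsGlobalAmbient lam) {p : ℝ × M × ℝ} (hp : p ∈ A.carrier) (i j : Fin n) :
    ricciCoord (baseBasis n) (A.leafMatrix p.2.1 p.2.2) i j (extChartAt (𝓡 n) p.2.1 p.2.1) +
      hessCoord (baseBasis n) (A.leafMatrix p.2.1 p.2.2)
        (coordFun (𝓡 n) (A.leafDensity lam p.1 p.2.2) p.2.1) i j
        (extChartAt (𝓡 n) p.2.1 p.2.1) -
      1 / 2 * (1 - lam * p.2.2) * pd (ambBasis n) (.inr (.inr ()))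
        (fun z => A.leafMatrix p.2.1 z.2.2 z.2.1 i j)
        (p.1, extChartAt (𝓡 n) p.2.1 p.2.1, p.2.2) -
      lam * A.leafMatrix p.2.1 p.2.2 (extChartAt (𝓡 n) p.2.1 p.2.1) i j = 0 := by
  have hU := hA.isOpen_coordDomain p.2.1
  have hy := mem_coordDomain hp
  have hg := hA.contDiffOn_leafMatrix p.2.1
  have hdet : ∀ z ∈ A.coordDomain p.2.1, IsUnit (A.leafMatrix p.2.1 z.2.2 z.2.1).det :=
    fun z hz => hA.isUnit_det_leafMatrix p.2.1 hz
  have heq := A.coordTensor_ambMetric_eventuallyEq p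
  have h := hA.P_eq_zero p hp (ambBasis n (.inr (.inl i))) (ambBasis n (.inr (.inl j)))
  unfold weightedP weightedRicci ricci hess at h
  rw [evalComponents_basis, evalComponents_basis, ← coordTensor_self (ambI n) (ambBasis n),
    extChartAt_amb, ricciCoord_congr heq, hessCoord_congr heq, heq.eq_of_nhds,
    ricciCoord_normal hU hg hdet hy,
    hessCoord_normal_xx hU hg hdet (hA.contDiffOn_coordFun p) hy, hA.pd_v_density hy] at h
  rw [← h]
  simp only [normalField, normalMatrix_xx]
  have : coordFun (𝓡 n) (A.leafDensity lam p.1 p.2.2) p.2.1 =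
    fun x => coordFun (ambI n) (A.ambDensity lam) p (p.1, x, p.2.2) := rfl
  rw [this]
  ring

/-- The equation `F̃ = 0`, expressed on the leaves and combined with the trace of `P̃ = 0`. -/
theorem leaf_F (hA : A.IsGlobalAmbient lam) {p : ℝ × M × ℝ} (hp : p ∈ A.carrier) :
    2 * (1 - lam * p.2.2) * pd (ambBasis n) (.inr (.inr ()))
        (coordFun (ambI n) (A.ambDensity lam) p) (p.1, extChartAt (𝓡 n) p.2.1 p.2.1, p.2.2) =
      scalar (𝓡 n) (baseBasis n) (A.metric p.2.2) p.2.1 +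
      gradSq (𝓡 n) (baseBasis n) (A.metric p.2.2) (A.leafDensity lam p.1 p.2.2) p.2.1 -
      2 * lam * A.ambDensity lam p := by
  have hU := hA.isOpen_coordDomain p.2.1
  have hy := mem_coordDomain hp
  have hg := hA.contDiffOn_leafMatrix p.2.1
  have hdet : ∀ z ∈ A.coordDomain p.2.1, IsUnit (A.leafMatrix p.2.1 z.2.2 z.2.1).det :=
    fun z hz => hA.isUnit_det_leafMatrix p.2.1 hz
  have hf := hA.contDiffOn_coordFun p
  have hP := hA.leaf_P hp
  have h := hA.F_eq_zero p hp
  have heq := A.coordTensor_ambMetric_eventuallyEq p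
  simp only [weightedF, laplacian, gradSq, extChartAt_amb, hessCoord_congr heq,
    heq.eq_of_nhds] at h
  rw [trace_hessCoord_normal hU hg hdet hf hy,
    gradSq_normal (hdet _ hy) (differentiableAt_of_contDiffOn hU hf hy), hA.pd_v_density hy,
    hA.pd_u_pd_v_density hy] at h
  have hdens : coordFun (𝓡 n) (A.leafDensity lam p.1 p.2.2) p.2.1 =
    fun x => coordFun (ambI n) (A.ambDensity lam) p (p.1, x, p.2.2) := rfl
  rw [← hdens] at h
  have hmat : coordTensor (𝓡 n) (baseBasis n) (A.metric p.2.2) p.2.1 =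
    A.leafMatrix p.2.1 p.2.2 := rfl
  simp only [scalar, gradSq, hmat]
  set ξ := extChartAt (𝓡 n) p.2.1 p.2.1
  set g := A.leafMatrix p.2.1 p.2.2
  -- Symmetry of `g` is needed because the trace contracts `(g⁻¹)ᵢⱼ` with `gᵢⱼ`, whereas matrix
  -- inversion gives `(g⁻¹)ᵢⱼ gⱼᵢ`.
  have hsymm : ∀ i j, g ξ i j = g ξ j i := fun i j => by
    have h1 := coordTensor_self (𝓡 n) (baseBasis n) (A.metric p.2.2) p.2.1
    simp only [hmat] at h1
    rw [h1, h1]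
    exact hA.symm p hp _ _
  have htr : ∑ i, ∑ j, (g ξ)⁻¹ i j * g ξ i j = n := by
    have h1 : (g ξ)⁻¹ * g ξ = 1 := Matrix.nonsing_inv_mul _ (hdet _ hy)
    have h2 : ∀ i, ∑ j, (g ξ)⁻¹ i j * g ξ i j = 1 := fun i => by
      have := congrFun (congrFun h1 i) i
      rw [Matrix.mul_apply, Matrix.one_apply_eq] at this
      rw [← this]
      exact Finset.sum_congr rfl fun j _ => by rw [hsymm]
    simp [h2]
  -- The Laplacian and the trace of `∂_u g` enter `F̃` in the same combination as in the trace of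
  -- `leaf_P`, so they are replaced together by `λn - R`.
  have htrace : ∑ i, ∑ j, (g ξ)⁻¹ i j *
      (hessCoord (baseBasis n) g (coordFun (𝓡 n) (A.leafDensity lam p.1 p.2.2) p.2.1) i j ξ +
        1 / 2 * pd (ambBasis n) (.inr (.inr ())) (fun z => A.leafMatrix p.2.1 z.2.2 z.2.1 i j)
          (p.1, ξ, p.2.2) * -(1 - lam * p.2.2)) =
      lam * n - ∑ i, ∑ j, (g ξ)⁻¹ i j * ricciCoord (baseBasis n) g i j ξ := by
    rw [← htr]
    simp only [Finset.mul_sum, ← Finset.sum_sub_distrib]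
    refine Finset.sum_congr rfl fun i _ => Finset.sum_congr rfl fun j _ => ?_
    linear_combination (g ξ)⁻¹ i j * hP i j
  rw [htrace] at h
  -- The ambient dimension is `n + 2`; the surplus `2λ` cancels against `2 ∂_u∂_v φ̃ = 2λ`.
  simp only [Fintype.card_sum, Fintype.card_unit, Fintype.card_fin, Nat.cast_add,
    Nat.cast_one] at h
  linear_combination h

end IsGlobalAmbient

end NormalSpace

/-! ### The rescaled members of the family are again ambient spaces. -/

theorem apply_eq_evalComponents {ι E H N : Type*} [Fintype ι]
    [NormedAddCommGroup E] [NormedSpace ℝ E] [TopologicalSpace H] [TopologicalSpace N]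
    [ChartedSpace H N] (I : ModelWithCorners ℝ E H) [I.Boundaryless] (b : Module.Basis ι ℝ E)
    (h : TwoTensor I N) (p : N) (X Y : TangentSpace I p) :
    h p X Y = evalComponents I b p (coordTensor I b h p (extChartAt I p p)) X Y := by
  let h' : LinearMap.BilinForm ℝ E := h p
  have hG : ∀ i j, coordTensor I b h p (extChartAt I p p) i j = h' (b i) (b j) := fun i j =>
    coordTensor_self I b h p i j
  change h' X Y = _
  simp only [evalComponents, hG]
  conv_lhs => rw [← b.sum_repr (X : E), ← b.sum_repr (Y : E)]
  rw [LinearMap.map_sum₂]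
  refine Finset.sum_congr rfl fun i _ => ?_
  rw [map_sum]
  refine Finset.sum_congr rfl fun j _ => ?_
  simp only [map_smul, LinearMap.smul_apply, smul_eq_mul]
  ring

theorem weightedP_eq_evalComponents {ι E H N : Type*} [Fintype ι] [DecidableEq ι]
    [NormedAddCommGroup E] [NormedSpace ℝ E] [TopologicalSpace H] [TopologicalSpace N]
    [ChartedSpace H N] (I : ModelWithCorners ℝ E H) [I.Boundaryless] (b : Module.Basis ι ℝ E)
    (h : TwoTensor I N) (φ : N → ℝ) (lam : ℝ) (p : N) (X Y : TangentSpace I p) :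
    weightedP I b h φ lam p X Y = evalComponents I b p (fun i j =>
      ricciCoord b (coordTensor I b h p) i j (extChartAt I p p) +
      hessCoord b (coordTensor I b h p) (coordFun I φ p) i j (extChartAt I p p) -
      lam * coordTensor I b h p (extChartAt I p p) i j) X Y := by
  rw [weightedP, weightedRicci, ricci, hess, apply_eq_evalComponents I b h p X Y]
  simp only [evalComponents, Finset.mul_sum, ← Finset.sum_add_distrib, ← Finset.sum_sub_distrib]
  exact Finset.sum_congr rfl fun i _ => Finset.sum_congr rfl fun j _ => by ring

/-- The dilation `(v, x, w) ↦ (v, x, w / c)` of the model space. -/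
def dilation (n : ℕ) {c : ℝ} (hc : c ≠ 0) :
    (ℝ × EuclideanSpace ℝ (Fin n) × ℝ) ≃L[ℝ] (ℝ × EuclideanSpace ℝ (Fin n) × ℝ) :=
  (ContinuousLinearEquiv.refl ℝ ℝ).prodCongr
    ((ContinuousLinearEquiv.refl ℝ (EuclideanSpace ℝ (Fin n))).prodCongr
      (LinearEquiv.smulOfNeZero ℝ ℝ c⁻¹ (inv_ne_zero hc)).toContinuousLinearEquiv)

theorem dilation_apply {n : ℕ} {c : ℝ} (hc : c ≠ 0) (y : ℝ × EuclideanSpace ℝ (Fin n) × ℝ) :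
    dilation n hc y = (y.1, y.2.1, y.2.2 / c) := by
  rw [div_eq_inv_mul]
  rfl

/-- The eigenvalues of `dilation` on the coordinate basis. -/
def dilationWeight (n : ℕ) (c : ℝ) : Unit ⊕ (Fin n ⊕ Unit) → ℝ
  | .inl _ => 1
  | .inr (.inl _) => 1
  | .inr (.inr _) => c⁻¹

theorem dilationWeight_ne_zero {n : ℕ} {c : ℝ} (hc : c ≠ 0) (I : Unit ⊕ (Fin n ⊕ Unit)) :
    dilationWeight n c I ≠ 0 := by
  rcases I with I | I | I <;> simp [dilationWeight, hc]

theorem dilation_basis {n : ℕ} {c : ℝ} (hc : c ≠ 0) (I : Unit ⊕ (Fin n ⊕ Unit)) :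
    dilation n hc (ambBasis n I) = dilationWeight n c I • ambBasis n I := by
  rcases I with I | I | I <;> simp [dilation_apply, dilationWeight]

namespace NormalSpace

theorem lamAt_eq (τ s : ℝ) : lamAt τ s = (2 * τ)⁻¹ / (1 - s / τ) := by
  rw [lamAt, tauAt, mul_inv, mul_inv, div_eq_mul_inv, mul_inv]
  ring

theorem one_sub_div_pos {τ s : ℝ} (hτ : 0 < τ) (hs : s < τ) : 0 < 1 - s / τ := by
  rw [sub_pos, div_lt_one hτ]
  exact hs

variable {n : ℕ} {M : Type*} [TopologicalSpace M] [ChartedSpace (EuclideanSpace ℝ (Fin n)) M]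
  (A : NormalSpace n M) {τ s : ℝ}

theorem mem_slice_carrier {p : ℝ × M × ℝ} :
    p ∈ (A.slice τ s).carrier ↔ (p.1, p.2.1, p.2.2 / (1 - s / τ)) ∈ A.carrier := Iff.rfl

theorem slice_ambDensity (p : ℝ × M × ℝ) : (A.slice τ s).ambDensity (lamAt τ s) p =
    A.ambDensity (2 * τ)⁻¹ (p.1, p.2.1, p.2.2 / (1 - s / τ)) := by
  rw [lamAt_eq]
  simp only [ambDensity, slice]
  ring

theorem slice_coordFun (hc : 1 - s / τ ≠ 0) (p q : ℝ × M × ℝ) (hpq : p.2.1 = q.2.1) :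
    coordFun (ambI n) ((A.slice τ s).ambDensity (lamAt τ s)) p =
      fun y => coordFun (ambI n) (A.ambDensity (2 * τ)⁻¹) q (dilation n hc y) := by
  ext y
  rw [dilation_apply, coordFun, slice_ambDensity, coordFun, extChartAt_amb_symm,
    extChartAt_amb_symm, hpq]

theorem slice_leafMatrix (x : M) (w : ℝ) (ξ : EuclideanSpace ℝ (Fin n)) (i j : Fin n) :
    (A.slice τ s).leafMatrix x w ξ i j =
      (1 - s / τ) * A.leafMatrix x (w / (1 - s / τ)) ξ i j := rfl

/-- The slice is a homothetic copy of the original space: in `du dv` the weight `c⁻¹` of the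
dilation cancels the factor `c`, and on the leaf block `c` remains. -/
theorem slice_normalField (hc : 1 - s / τ ≠ 0) (x : M) (y : ℝ × EuclideanSpace ℝ (Fin n) × ℝ)
    (I J : Unit ⊕ (Fin n ⊕ Unit)) :
    normalField ((A.slice τ s).leafMatrix x) y I J = (1 - s / τ) *
      (dilationWeight n (1 - s / τ) I * dilationWeight n (1 - s / τ) J) *
      normalField (A.leafMatrix x) (dilation n hc y) I J := by
  rw [dilation_apply]
  rcases I with I | I | I <;> rcases J with J | J | J <;>
    simp [normalField, dilationWeight, slice_leafMatrix, hc]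

theorem dilation_mem_coordDomain (hc : 1 - s / τ ≠ 0) {x : M}
    {y : ℝ × EuclideanSpace ℝ (Fin n) × ℝ} (hy : y ∈ (A.slice τ s).coordDomain x) :
    dilation n hc y ∈ A.coordDomain x := by
  rw [dilation_apply]
  exact hy

/-- The components of `P̃` in the chart at `p`. -/
theorem weightedP_apply [IsManifold (𝓡 n) ∞ M] (lam : ℝ) (p : ℝ × M × ℝ)
    (X Y : TangentSpace (ambI n) p) :
    weightedP (ambI n) (ambBasis n) A.ambMetric (A.ambDensity lam) lam p X Y =
      evalComponents (ambI n) (ambBasis n) p (fun I J =>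
        ricciCoord (ambBasis n) (normalField (A.leafMatrix p.2.1)) I J
          (p.1, extChartAt (𝓡 n) p.2.1 p.2.1, p.2.2) +
        hessCoord (ambBasis n) (normalField (A.leafMatrix p.2.1))
          (coordFun (ambI n) (A.ambDensity lam) p) I J
          (p.1, extChartAt (𝓡 n) p.2.1 p.2.1, p.2.2) -
        lam * normalField (A.leafMatrix p.2.1)
          (p.1, extChartAt (𝓡 n) p.2.1 p.2.1, p.2.2) I J) X Y := by
  have heq := A.coordTensor_ambMetric_eventuallyEq p
  rw [weightedP_eq_evalComponents, extChartAt_amb]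
  simp only [ricciCoord_congr heq, hessCoord_congr heq, heq.eq_of_nhds]

theorem weightedF_apply [IsManifold (𝓡 n) ∞ M] (lam : ℝ) (p : ℝ × M × ℝ) :
    weightedF (ambI n) (ambBasis n) A.ambMetric (A.ambDensity lam) lam p =
      ∑ I, ∑ J, (normalField (A.leafMatrix p.2.1)
          (p.1, extChartAt (𝓡 n) p.2.1 p.2.1, p.2.2))⁻¹ I J *
        hessCoord (ambBasis n) (normalField (A.leafMatrix p.2.1))
          (coordFun (ambI n) (A.ambDensity lam) p) I J
          (p.1, extChartAt (𝓡 n) p.2.1 p.2.1, p.2.2) -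
      ∑ I, ∑ J, (normalField (A.leafMatrix p.2.1)
          (p.1, extChartAt (𝓡 n) p.2.1 p.2.1, p.2.2))⁻¹ I J *
        pd (ambBasis n) I (coordFun (ambI n) (A.ambDensity lam) p)
          (p.1, extChartAt (𝓡 n) p.2.1 p.2.1, p.2.2) *
        pd (ambBasis n) J (coordFun (ambI n) (A.ambDensity lam) p)
          (p.1, extChartAt (𝓡 n) p.2.1 p.2.1, p.2.2) +
      2 * lam * A.ambDensity lam p - (n + 2) * lam := by
  have heq := A.coordTensor_ambMetric_eventuallyEq p
  simp only [weightedF, laplacian, gradSq, extChartAt_amb, hessCoord_congr heq, heq.eq_of_nhds,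
    Fintype.card_sum, Fintype.card_unit, Fintype.card_fin, Nat.cast_add, Nat.cast_one]
  ring

variable {A}

theorem IsGlobalAmbient.slice [IsManifold (𝓡 n) ∞ M] (hτ : 0 < τ)
    (hA : A.IsGlobalAmbient (2 * τ)⁻¹) (hs : s < τ) :
    (A.slice τ s).IsGlobalAmbient (lamAt τ s) := by
  have hpos := one_sub_div_pos hτ hs
  have hc := hpos.ne'
  have hw := dilationWeight_ne_zero (n := n) hc
  have hcont : Continuous fun p : ℝ × M × ℝ => (p.1, p.2.1, p.2.2 / (1 - s / τ)) := by fun_prop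
  have hlam : ∀ w, lamAt τ s * w = (2 * τ)⁻¹ * (w / (1 - s / τ)) := fun w => by
    rw [lamAt_eq]
    ring
  have hopen : IsOpen (A.slice τ s).carrier := hA.isOpen_carrier.preimage hcont
  refine ⟨hopen, fun v x => ?_, fun v x => ?_, fun p hp => ?_, fun p hp t => ?_, fun p hp X Y => ?_,
    fun p hp X hX => ?_, fun p I J => ?_, ?_, fun p hp X Y => ?_, fun p hp => ?_⟩
  · rw [mem_slice_carrier]
    simpa using hA.zero_mem v x
  · exact (hA.interval v x).preimage_mono fun a b hab =>
      div_le_div_of_nonneg_right hab hpos.le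
  · rw [hlam]
    exact hA.dilation_defined _ hp
  · rw [hlam]
    exact hA.dilation_mem _ hp t
  · exact congrArg (fun r => (1 - s / τ) * r) (hA.symm _ hp X Y)
  · exact mul_pos hpos (hA.pos _ hp X hX)
  · rw [← coordDomain_eq]
    have h := (contDiffOn_normalField (hA.contDiffOn_leafMatrix p.2.1) I J).comp
      (dilation n hc).contDiff.contDiffOn
      (fun y (hy : y ∈ (A.slice τ s).coordDomain p.2.1) => A.dilation_mem_coordDomain hc hy)
    refine (contDiffOn_const (c := (1 - s / τ) * (dilationWeight n (1 - s / τ) I *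
      dilationWeight n (1 - s / τ) J)) |>.mul h).congr fun y hy => ?_
    rw [coordTensor_ambMetric _ hy.1, A.slice_normalField hc]
    rfl
  · have h : ContMDiff (ambI n) (ambI n) ∞
        fun p : ℝ × M × ℝ => (p.1, p.2.1, p.2.2 / (1 - s / τ)) :=
      contMDiff_fst.prodMk ((contMDiff_fst.comp contMDiff_snd).prodMk
        ((contDiff_id.div_const (1 - s / τ)).contMDiff.comp
          (contMDiff_snd.comp contMDiff_snd)))
    refine (hA.smooth_density.comp h.contMDiffOn fun p hp => hp).congr fun p _ => ?_
    exact A.slice_ambDensity p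
  · set q : ℝ × M × ℝ := (p.1, p.2.1, p.2.2 / (1 - s / τ)) with hq
    -- Testing `P̃ = 0` at the original point on basis vectors shows that each of its components
    -- vanishes.
    have hcomp : ∀ I J, _ := fun I J =>
      (evalComponents_basis (ambI n) (ambBasis n) q _ I J).symm.trans
        ((A.weightedP_apply (2 * τ)⁻¹ q (ambBasis n I) (ambBasis n J)).symm.trans
          (hA.P_eq_zero q hp (ambBasis n I) (ambBasis n J)))
    rw [weightedP_apply, evalComponents]
    refine Finset.sum_eq_zero fun I _ => Finset.sum_eq_zero fun J _ => ?_
    rw [ricciCoord_scale (dilation_basis hc) hc hw (A.slice_normalField hc p.2.1),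
      slice_coordFun A hc p q rfl,
      hessCoord_scale (dilation_basis hc) hc hw (A.slice_normalField hc p.2.1),
      A.slice_normalField hc, dilation_apply, lamAt_eq]
    have h := hcomp I J
    simp only [hq] at h ⊢
    -- The product of `λ` with the metric is scale invariant, so `P̃` of the slice is the pullback
    -- of the original `P̃`.
    have : (2 * τ)⁻¹ / (1 - s / τ) * (1 - s / τ) = (2 * τ)⁻¹ := div_mul_cancel₀ _ hc
    linear_combination (dilationWeight n (1 - s / τ) I * dilationWeight n (1 - s / τ) J) *
      ((ambBasis n).repr X I * (ambBasis n).repr Y J) * h -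
      (dilationWeight n (1 - s / τ) I * dilationWeight n (1 - s / τ) J) *
      ((ambBasis n).repr X I * (ambBasis n).repr Y J) *
      normalField (A.leafMatrix p.2.1) (p.1, extChartAt (𝓡 n) p.2.1 p.2.1,
        p.2.2 / (1 - s / τ)) I J * this
  · set q : ℝ × M × ℝ := (p.1, p.2.1, p.2.2 / (1 - s / τ)) with hq
    have h := hA.F_eq_zero q hp
    rw [weightedF_apply] at h ⊢
    rw [slice_coordFun A hc p q rfl]
    have hinv := fun I J => inv_diagonal_conj hc hw _ _
      (A.slice_normalField hc p.2.1 (p.1, extChartAt (𝓡 n) p.2.1 p.2.1, p.2.2)) I J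
    -- In a full contraction the weights of the dilation cancel, and only `c⁻¹` from the inverse
    -- metric remains.
    have key₁ : ∀ {a b : ℝ}, a ≠ 0 → b ≠ 0 → ∀ c m h : ℝ,
        c * (a⁻¹ * b⁻¹) * m * (a * b * h) = c * (m * h) := fun ha hb c m h => by
      field_simp
    have key₂ : ∀ {a b : ℝ}, a ≠ 0 → b ≠ 0 → ∀ c m x y : ℝ,
        c * (a⁻¹ * b⁻¹) * m * (a * x) * (b * y) = c * (m * x * y) := fun ha hb c m x y => by
      field_simp
    have h1 : ∀ I J, (normalField ((A.slice τ s).leafMatrix p.2.1)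
        (p.1, extChartAt (𝓡 n) p.2.1 p.2.1, p.2.2))⁻¹ I J *
        hessCoord (ambBasis n) (normalField ((A.slice τ s).leafMatrix p.2.1))
          (fun y => coordFun (ambI n) (A.ambDensity (2 * τ)⁻¹) q (dilation n hc y)) I J
          (p.1, extChartAt (𝓡 n) p.2.1 p.2.1, p.2.2) = (1 - s / τ)⁻¹ *
        ((normalField (A.leafMatrix q.2.1) (q.1, extChartAt (𝓡 n) q.2.1 q.2.1, q.2.2))⁻¹ I J *
        hessCoord (ambBasis n) (normalField (A.leafMatrix q.2.1))
          (coordFun (ambI n) (A.ambDensity (2 * τ)⁻¹) q) I J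
          (q.1, extChartAt (𝓡 n) q.2.1 q.2.1, q.2.2)) := fun I J => by
      rw [hinv, hessCoord_scale (dilation_basis hc) hc hw (A.slice_normalField hc p.2.1),
        dilation_apply]
      exact key₁ (hw I) (hw J) _ _ _
    have h2 : ∀ I J, (normalField ((A.slice τ s).leafMatrix p.2.1)
        (p.1, extChartAt (𝓡 n) p.2.1 p.2.1, p.2.2))⁻¹ I J *
        pd (ambBasis n) I
          (fun y => coordFun (ambI n) (A.ambDensity (2 * τ)⁻¹) q (dilation n hc y))
          (p.1, extChartAt (𝓡 n) p.2.1 p.2.1, p.2.2) *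
        pd (ambBasis n) J
          (fun y => coordFun (ambI n) (A.ambDensity (2 * τ)⁻¹) q (dilation n hc y))
          (p.1, extChartAt (𝓡 n) p.2.1 p.2.1, p.2.2) = (1 - s / τ)⁻¹ *
        ((normalField (A.leafMatrix q.2.1) (q.1, extChartAt (𝓡 n) q.2.1 q.2.1, q.2.2))⁻¹ I J *
        pd (ambBasis n) I (coordFun (ambI n) (A.ambDensity (2 * τ)⁻¹) q)
          (q.1, extChartAt (𝓡 n) q.2.1 q.2.1, q.2.2) *
        pd (ambBasis n) J (coordFun (ambI n) (A.ambDensity (2 * τ)⁻¹) q)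
          (q.1, extChartAt (𝓡 n) q.2.1 q.2.1, q.2.2)) := fun I J => by
      rw [hinv, pd_comp_equiv _ (dilation_basis hc) _ (coordFun (ambI n) _ q),
        pd_comp_equiv _ (dilation_basis hc) _ (coordFun (ambI n) _ q), dilation_apply]
      exact key₂ (hw I) (hw J) _ _ _ _
    simp only [h1, h2, ← Finset.mul_sum]
    rw [slice_ambDensity, lamAt_eq, ← hq]
    linear_combination (1 - s / τ)⁻¹ * h

end NormalSpace

/-! ### The total space -/

namespace NormalSpace

variable {n : ℕ} {M : Type*} [TopologicalSpace M] [ChartedSpace (EuclideanSpace ℝ (Fin n)) M]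
  (A : NormalSpace n M) {τ s : ℝ}

/-- The matrix of the degenerate form `g` in the basis `∂_v, ∂_i, ∂_u, ∂_s`. -/
def totMatrix (g : Matrix (Fin n) (Fin n) ℝ) :
    Matrix ((Unit ⊕ (Fin n ⊕ Unit)) ⊕ Unit) ((Unit ⊕ (Fin n ⊕ Unit)) ⊕ Unit) ℝ
  | .inl (.inr (.inl i)), .inl (.inr (.inl j)) => g i j
  | _, _ => 0

theorem totBasis_inl (I : Unit ⊕ (Fin n ⊕ Unit)) : totBasis n (.inl I) = (ambBasis n I, 0) := by
  simp [totBasis]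

theorem totBasis_inr (a : Unit) : totBasis n (.inr a) = (0, 1) := by
  simp [totBasis]

theorem uAt_div (hc : 1 - s / τ ≠ 0) (u : ℝ) : uAt τ s u / (1 - s / τ) = u :=
  mul_div_cancel_left₀ u hc

theorem lamAt_mul_uAt (hc : 1 - s / τ ≠ 0) (u : ℝ) : lamAt τ s * uAt τ s u = (2 * τ)⁻¹ * u := by
  rw [lamAt_eq, div_mul_eq_mul_div, mul_div_assoc, uAt_div hc]

theorem hasFDerivAt_tot_coordChange {P Q : (ℝ × M × ℝ) × ℝ}
    {y : (ℝ × EuclideanSpace ℝ (Fin n) × ℝ) × ℝ}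
    {D : EuclideanSpace ℝ (Fin n) →L[ℝ] EuclideanSpace ℝ (Fin n)}
    (hD : HasFDerivAt (fun z => extChartAt (𝓡 n) Q.1.2.1 ((extChartAt (𝓡 n) P.1.2.1).symm z)) D
      y.1.2.1) :
    HasFDerivAt (fun z => extChartAt (totI n) Q ((extChartAt (totI n) P).symm z))
      (((ContinuousLinearMap.id ℝ ℝ).prodMap (D.prodMap (ContinuousLinearMap.id ℝ ℝ))).prodMap
        (ContinuousLinearMap.id ℝ ℝ)) y :=
  HasFDerivAt.prodMap (f₂ := id) y (hasFDerivAt_amb_coordChange (p := P.1) (q := Q.1) hD)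
    (hasFDerivAt_id _)

theorem extChartAt_tot_symm (P : (ℝ × M × ℝ) × ℝ)
    (y : (ℝ × EuclideanSpace ℝ (Fin n) × ℝ) × ℝ) :
    (extChartAt (totI n) P).symm y =
      ((y.1.1, (extChartAt (𝓡 n) P.1.2.1).symm y.1.2.1, y.1.2.2), y.2) := rfl

theorem extChartAt_tot (P Q : (ℝ × M × ℝ) × ℝ) :
    extChartAt (totI n) P Q = ((Q.1.1, extChartAt (𝓡 n) P.1.2.1 Q.1.2.1, Q.1.2.2), Q.2) := rfl

theorem totMetric_apply (P : (ℝ × M × ℝ) × ℝ)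
    (X Y : (ℝ × EuclideanSpace ℝ (Fin n) × ℝ) × ℝ) :
    A.totMetric τ P X Y = (A.slice τ P.2).leafForm (uAt τ P.2 P.1.2.2) P.1.2.1 X.1.2.1 Y.1.2.1 :=
  rfl

/-- At fixed `(v, x, u)` the density does not depend on `s`, so `∂_s` contributes nothing to `L_Y
φ`. -/
theorem totDensity_eq {q : (ℝ × M × ℝ) × ℝ} (hc : 1 - q.2 / τ ≠ 0) :
    A.totDensity τ q = A.ambDensity (2 * τ)⁻¹ q.1 := by
  rw [totDensity, slice_ambDensity]
  simp only [uAt_div hc]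

theorem eventually_one_sub_div_ne_zero {α : Type*} [TopologicalSpace α] {f : α → ℝ} {a : α}
    (hf : ContinuousAt f a) (hc : 1 - f a / τ ≠ 0) : ∀ᶠ q in 𝓝 a, 1 - f q / τ ≠ 0 :=
  (continuousAt_const.sub (hf.div_const τ)).eventually_ne hc

theorem eventually_mem_target (P : (ℝ × M × ℝ) × ℝ) :
    ∀ᶠ y in 𝓝 (extChartAt (totI n) P P), y.1.2.1 ∈ (extChartAt (𝓡 n) P.1.2.1).target :=
  (show Continuous fun y : (ℝ × EuclideanSpace ℝ (Fin n) × ℝ) × ℝ => y.1.2.1 by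
    fun_prop).continuousAt.eventually_mem
    ((isOpen_extChartAt_target (I := 𝓡 n) P.1.2.1).mem_nhds
      (mem_extChartAt_target (I := 𝓡 n) P.1.2.1))

theorem coordField_flowField (p : ℝ × M × ℝ) (K : (Unit ⊕ (Fin n ⊕ Unit)) ⊕ Unit) :
    coordField (totI n) (totBasis n) (A.flowField τ) (p, s) K (extChartAt (totI n) (p, s) (p, s)) =
      (totBasis n).repr (A.flowField τ (p, s)) K := by
  rw [coordField_apply (totI n) (totBasis n) _ (extChartAt_to_inv (I := totI n) (p, s))
    (hasFDerivAt_chart_self (totI n) (p, s))]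
  rfl

theorem mem_slice_of_mem (hc : 1 - s / τ ≠ 0) {A : NormalSpace n M} {p : ℝ × M × ℝ} (hp : p ∈ A.carrier) :
    (p.1, p.2.1, uAt τ s p.2.2) ∈ (A.slice τ s).carrier := by
  rw [mem_slice_carrier]
  simpa only [uAt_div hc] using hp

theorem dilation_uAt (hc : 1 - s / τ ≠ 0) (v : ℝ) (ξ : EuclideanSpace ℝ (Fin n)) (u : ℝ) :
    dilation n hc (v, ξ, uAt τ s u) = (v, ξ, u) := by
  rw [dilation_apply]
  simp only [uAt_div hc]

theorem pd_u_slice (A : NormalSpace n M) (hc : 1 - s / τ ≠ 0) (p : ℝ × M × ℝ) :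
    pd (ambBasis n) (.inr (.inr ()))
      (coordFun (ambI n) ((A.slice τ s).ambDensity (lamAt τ s)) (p.1, p.2.1, uAt τ s p.2.2))
      (p.1, extChartAt (𝓡 n) p.2.1 p.2.1, uAt τ s p.2.2) =
    (1 - s / τ)⁻¹ * pd (ambBasis n) (.inr (.inr ())) (coordFun (ambI n) (A.ambDensity (2 * τ)⁻¹) p)
      (p.1, extChartAt (𝓡 n) p.2.1 p.2.1, p.2.2) := by
  rw [A.slice_coordFun hc (p.1, p.2.1, uAt τ s p.2.2) p rfl, pd_comp_equiv _ (dilation_basis hc) _ (coordFun (ambI n) _ p),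
    dilation_uAt hc, dilationWeight]

/-- The derivative of the ambient density in coordinates. -/
theorem IsGlobalAmbient.mfderiv_ambDensity {A : NormalSpace n M} {lam : ℝ} (hA : A.IsGlobalAmbient lam) {p : ℝ × M × ℝ}
    (hp : p ∈ A.carrier) (a b : ℝ) :
    (mfderiv (ambI n) 𝓘(ℝ, ℝ) (A.ambDensity lam) p (a, (0 : EuclideanSpace ℝ (Fin n)), b) : ℝ) =
      a * pd (ambBasis n) (.inl ()) (coordFun (ambI n) (A.ambDensity lam) p)
        (p.1, extChartAt (𝓡 n) p.2.1 p.2.1, p.2.2) +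
      b * pd (ambBasis n) (.inr (.inr ())) (coordFun (ambI n) (A.ambDensity lam) p)
        (p.1, extChartAt (𝓡 n) p.2.1 p.2.1, p.2.2) := by
  have hd : MDifferentiableAt (ambI n) 𝓘(ℝ, ℝ) (A.ambDensity lam) p :=
    (hA.smooth_density.contMDiffAt (hA.isOpen_carrier.mem_nhds hp)).mdifferentiableAt (by simp)
  have h1 : mfderiv (ambI n) 𝓘(ℝ, ℝ) (A.ambDensity lam) p =
      fderiv ℝ (coordFun (ambI n) (A.ambDensity lam) p)
        (p.1, extChartAt (𝓡 n) p.2.1 p.2.1, p.2.2) := by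
    rw [hd.mfderiv, (ambI n).range_eq_univ, fderivWithin_univ]
    rfl
  have h2 : ((a, (0 : EuclideanSpace ℝ (Fin n)), b) : ℝ × EuclideanSpace ℝ (Fin n) × ℝ) =
      a • ambBasis n (.inl ()) + b • ambBasis n (.inr (.inr ())) := by
    simp
  rw [h1]
  change fderiv ℝ (coordFun (ambI n) (A.ambDensity lam) p) _
    ((a, (0 : EuclideanSpace ℝ (Fin n)), b) : ℝ × EuclideanSpace ℝ (Fin n) × ℝ) = _
  rw [h2, map_add, map_smul, map_smul]
  rfl

theorem lieFun_totTau (hτ : τ ≠ 0) (p : ℝ × M × ℝ) :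
    lieFun (totI n) (A.flowField τ) (totTau M τ) (p, s) = -1 := by
  have h0 : HasFDerivAt (fun r : ℝ => r) (ContinuousLinearMap.id ℝ ℝ) s := hasFDerivAt_id s
  have h1 : HasFDerivAt (fun r : ℝ => (1 - r * τ⁻¹) * τ) _ s :=
    ((h0.mul_const τ⁻¹).const_sub 1).mul_const τ
  have h2 : HasMFDerivAt (totI n) 𝓘(ℝ, ℝ) (totTau M τ) (p, s) _ :=
    HasMFDerivAt.comp (p, s) (g := fun r : ℝ => (1 - r * τ⁻¹) * τ) (f := Prod.snd)
      h1.hasMFDerivAt (hasMFDerivAt_snd (I := ambI n) (I' := 𝓘(ℝ, ℝ)) (p, s))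
  rw [lieFun, h2.mfderiv]
  change τ * -(τ⁻¹ * (1 : ℝ)) = -1
  field_simp

variable [IsManifold (𝓡 n) ∞ M]

theorem coordTensor_totMetric {P : (ℝ × M × ℝ) × ℝ} (hc : 1 - P.2 / τ ≠ 0) :
    coordTensor (totI n) (totBasis n) (A.totMetric τ) P =ᶠ[𝓝 (extChartAt (totI n) P P)]
      fun y => totMatrix ((1 - y.2 / τ) • A.leafMatrix P.1.2.1 y.1.2.2 y.1.2.1) := by
  have : IsManifold (𝓡 n) 1 M := IsManifold.of_le (n := ∞) (by norm_cast)
  filter_upwards [eventually_mem_target P,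
    eventually_one_sub_div_ne_zero (τ := τ) (f := Prod.snd) continuousAt_snd hc] with y hy hcy
  obtain ⟨D, hD⟩ : ∃ D, HasFDerivAt (fun z => extChartAt (𝓡 n)
      ((extChartAt (𝓡 n) P.1.2.1).symm y.1.2.1) ((extChartAt (𝓡 n) P.1.2.1).symm z)) D y.1.2.1 :=
    ⟨_, hasFDerivAt_coordChange (𝓡 n) hy
      (mem_extChartAt_source ((extChartAt (𝓡 n) P.1.2.1).symm y.1.2.1))⟩
  ext I J
  rw [coordTensor_apply (totI n) (totBasis n) (A.totMetric τ) (extChartAt_tot_symm P y)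
    (hasFDerivAt_tot_coordChange hD), totMetric_apply]
  rcases I with (I | I | I) | I <;> rcases J with (J | J | J) | J <;>
    simp [totMatrix, totBasis_inl, totBasis_inr]
  rw [leafMatrix, coordTensor_apply (𝓡 n) (baseBasis n) (A.metric y.1.2.2) rfl hD I J]
  change (1 - y.2 / τ) * A.leafForm (uAt τ y.2 y.1.2.2 / (1 - y.2 / τ)) _ _ _ = _
  rw [uAt_div hcy]
  rfl

/-- Coordinate changes act blockwise, so a vanishing `M`-component stays zero in every chart. `Y`
itself need not be differentiable. -/
theorem coordField_x_eventually_eq_zero (Y : (Q : (ℝ × M × ℝ) × ℝ) → TangentSpace (totI n) Q)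
    (hY : ∀ Q, (dx n (Y Q).1) = 0) (P : (ℝ × M × ℝ) × ℝ) (k : Fin n) :
    coordField (totI n) (totBasis n) Y P (.inl (.inr (.inl k))) =ᶠ[𝓝 (extChartAt (totI n) P P)]
      fun _ => 0 := by
  have : IsManifold (𝓡 n) 1 M := IsManifold.of_le (n := ∞) (by norm_cast)
  filter_upwards [eventually_mem_target P] with y hy
  set x := (extChartAt (𝓡 n) P.1.2.1).symm y.1.2.1 with hx
  obtain ⟨D, hD⟩ : ∃ D, HasFDerivAt (fun z => extChartAt (𝓡 n) P.1.2.1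
      ((extChartAt (𝓡 n) x).symm z)) D (extChartAt (𝓡 n) x x) :=
    ⟨_, hasFDerivAt_coordChange (𝓡 n) (mem_extChartAt_target x) (by
      rw [extChartAt_to_inv]
      exact (extChartAt (𝓡 n) P.1.2.1).map_target hy)⟩
  rw [coordField_apply (totI n) (totBasis n) Y (extChartAt_tot_symm P y)
    (hasFDerivAt_tot_coordChange hD)]
  have h0 := hY ((y.1.1, x, y.1.2.2), y.2)
  have h1 : ∀ Z : (ℝ × EuclideanSpace ℝ (Fin n) × ℝ) × ℝ,
      (totBasis n).repr Z (.inl (.inr (.inl k))) = (baseBasis n).repr Z.1.2.1 k := fun Z => by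
    simp [totBasis, ambBasis]
  rw [h1]
  change (baseBasis n).repr (D (dx n (Y ((y.1.1, x, y.1.2.2), y.2)).1)) k = 0
  rw [h0, map_zero, map_zero]
  rfl

theorem pd_tot_inl {a : ℝ × EuclideanSpace ℝ (Fin n) × ℝ → ℝ}
    {y : (ℝ × EuclideanSpace ℝ (Fin n) × ℝ) × ℝ} (ha : DifferentiableAt ℝ a y.1)
    (I : Unit ⊕ (Fin n ⊕ Unit)) :
    pd (totBasis n) (.inl I) (fun z => (1 - z.2 / τ) * a z.1) y =
      (1 - y.2 / τ) * pd (ambBasis n) I a y.1 := by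
  have h0 : HasFDerivAt (fun z : (ℝ × EuclideanSpace ℝ (Fin n) × ℝ) × ℝ => z.2)
      (ContinuousLinearMap.snd ℝ (ℝ × EuclideanSpace ℝ (Fin n) × ℝ) ℝ) y := hasFDerivAt_snd
  have h1 : HasFDerivAt (fun z : (ℝ × EuclideanSpace ℝ (Fin n) × ℝ) × ℝ => 1 - z.2 * τ⁻¹) _ y :=
    (h0.mul_const τ⁻¹).const_sub 1
  have h2 : HasFDerivAt (fun z : (ℝ × EuclideanSpace ℝ (Fin n) × ℝ) × ℝ => a z.1) _ y :=
    ha.hasFDerivAt.comp y hasFDerivAt_fst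
  simp only [div_eq_mul_inv]
  have h3 : HasFDerivAt (fun z : (ℝ × EuclideanSpace ℝ (Fin n) × ℝ) × ℝ =>
      (1 - z.2 * τ⁻¹) * a z.1) _ y := h1.mul h2
  rw [pd, h3.fderiv]
  simp [totBasis_inl, pd]

theorem pd_tot_inr {a : ℝ × EuclideanSpace ℝ (Fin n) × ℝ → ℝ}
    {y : (ℝ × EuclideanSpace ℝ (Fin n) × ℝ) × ℝ} (ha : DifferentiableAt ℝ a y.1) (i : Unit) :
    pd (totBasis n) (.inr i) (fun z => (1 - z.2 / τ) * a z.1) y = -(1 / τ) * a y.1 := by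
  have h0 : HasFDerivAt (fun z : (ℝ × EuclideanSpace ℝ (Fin n) × ℝ) × ℝ => z.2)
      (ContinuousLinearMap.snd ℝ (ℝ × EuclideanSpace ℝ (Fin n) × ℝ) ℝ) y := hasFDerivAt_snd
  have h1 : HasFDerivAt (fun z : (ℝ × EuclideanSpace ℝ (Fin n) × ℝ) × ℝ => 1 - z.2 * τ⁻¹) _ y :=
    (h0.mul_const τ⁻¹).const_sub 1
  have h2 : HasFDerivAt (fun z : (ℝ × EuclideanSpace ℝ (Fin n) × ℝ) × ℝ => a z.1) _ y :=
    ha.hasFDerivAt.comp y hasFDerivAt_fst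
  simp only [div_eq_mul_inv]
  have h3 : HasFDerivAt (fun z : (ℝ × EuclideanSpace ℝ (Fin n) × ℝ) × ℝ =>
      (1 - z.2 * τ⁻¹) * a z.1) _ y := h1.mul h2
  rw [pd, h3.fderiv]
  simp [totBasis_inr]
  ring

variable {A}

/-- The first flow equation in components. -/
theorem IsGlobalAmbient.flow_metric (hτ : 0 < τ) (hA : A.IsGlobalAmbient (2 * τ)⁻¹) (hs : s < τ)
    {p : ℝ × M × ℝ} (hp : p ∈ A.carrier) (I J : (Unit ⊕ (Fin n ⊕ Unit)) ⊕ Unit) :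
    ∑ K, (totBasis n).repr (A.flowField τ (p, s)) K *
      pd (totBasis n) K (fun y => totMatrix
        ((1 - y.2 / τ) • A.leafMatrix p.2.1 y.1.2.2 y.1.2.1) I J)
        ((p.1, extChartAt (𝓡 n) p.2.1 p.2.1, p.2.2), s) =
    totMatrix (Matrix.of fun i j => -2 * (
      ricciCoord (baseBasis n) ((A.slice τ s).leafMatrix p.2.1 (uAt τ s p.2.2)) i j
        (extChartAt (𝓡 n) p.2.1 p.2.1) +
      hessCoord (baseBasis n) ((A.slice τ s).leafMatrix p.2.1 (uAt τ s p.2.2))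
        (coordFun (𝓡 n) ((A.slice τ s).leafDensity (lamAt τ s) p.1 (uAt τ s p.2.2)) p.2.1) i j
        (extChartAt (𝓡 n) p.2.1 p.2.1))) I J := by
  have hc := (one_sub_div_pos hτ hs).ne'
  have hy := mem_coordDomain hp
  rcases I with (I | I | I) | I <;> rcases J with (J | J | J) | J <;>
    simp only [totMatrix, pd_const, mul_zero, Finset.sum_const_zero, Matrix.smul_apply, smul_eq_mul,
      Matrix.of_apply]
  have hd := differentiableAt_of_contDiffOn (hA.isOpen_coordDomain p.2.1)
    (hA.contDiffOn_leafMatrix p.2.1 I J) hy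
  have hl := (hA.slice hτ hs).leaf_P (mem_slice_of_mem hc hp) I J
  simp only at hl
  have hpd : pd (ambBasis n) (.inr (.inr ()))
      (fun z => (A.slice τ s).leafMatrix p.2.1 z.2.2 z.2.1 I J)
        (p.1, extChartAt (𝓡 n) p.2.1 p.2.1, uAt τ s p.2.2) =
      pd (ambBasis n) (.inr (.inr ())) (fun z => A.leafMatrix p.2.1 z.2.2 z.2.1 I J)
        (p.1, extChartAt (𝓡 n) p.2.1 p.2.1, p.2.2) := by
    have h1 : (fun z : ℝ × EuclideanSpace ℝ (Fin n) × ℝ =>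
        (A.slice τ s).leafMatrix p.2.1 z.2.2 z.2.1 I J) =
        fun z => (1 - s / τ) * (fun z : ℝ × EuclideanSpace ℝ (Fin n) × ℝ =>
          A.leafMatrix p.2.1 z.2.2 z.2.1 I J) (dilation n hc z) := by
      ext z
      rw [slice_leafMatrix, dilation_apply]
    rw [h1, pd_const_mul, pd_comp_equiv _ (dilation_basis hc) _
      (fun z : ℝ × EuclideanSpace ℝ (Fin n) × ℝ => A.leafMatrix p.2.1 z.2.2 z.2.1 I J),
      dilation_uAt hc, dilationWeight, mul_inv_cancel_left₀ hc]
  -- The factor `c` of the slice metric and the `c⁻¹` of `∂_{u(s)}` have cancelled in `hpd`, leaving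
  -- `∂_u` of the original family.
  rw [hpd, slice_leafMatrix, uAt_div hc, lamAt_mul_uAt hc, lamAt_eq] at hl
  have hv : pd (ambBasis n) (.inl ()) (fun z => A.leafMatrix p.2.1 z.2.2 z.2.1 I J)
      (p.1, extChartAt (𝓡 n) p.2.1 p.2.1, p.2.2) = 0 := pd_v_eq_zero (fun _ _ _ _ => rfl) _ _
  have hYx : ∀ k, (totBasis n).repr (A.flowField τ (p, s)) (.inl (.inr (.inl k))) = 0 :=
    fun k => by simp [totBasis, ambBasis, flowField]
  have hYu : (totBasis n).repr (A.flowField τ (p, s)) (.inl (.inr (.inr ()))) =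
      -(1 - (2 * τ)⁻¹ * p.2.2) * (1 - s / τ)⁻¹ := by
    simp [totBasis, ambBasis, flowField, lamAt_mul_uAt hc]
  have hYs : (totBasis n).repr (A.flowField τ (p, s)) (.inr ()) = 1 := by
    simp [totBasis, flowField]
  simp only [Fintype.sum_sum_type, Finset.univ_unique, Finset.sum_singleton, PUnit.default_eq_unit,
    hYx, hYu, hYs, zero_mul, Finset.sum_const_zero]
  have e := pd_tot_inl (τ := τ) (y := ((p.1, extChartAt (𝓡 n) p.2.1 p.2.1, p.2.2), s)) hd
  have e' := pd_tot_inr (τ := τ) (y := ((p.1, extChartAt (𝓡 n) p.2.1 p.2.1, p.2.2), s)) hd ()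
  simp only at e e'
  rw [e, e, e', hv]
  have hτ' := hτ.ne'
  have h1 : (2 * τ)⁻¹ / (1 - s / τ) * ((1 - s / τ) *
      A.leafMatrix p.2.1 p.2.2 (extChartAt (𝓡 n) p.2.1 p.2.1) I J) =
      (2 * τ)⁻¹ * A.leafMatrix p.2.1 p.2.2 (extChartAt (𝓡 n) p.2.1 p.2.1) I J := by
    rw [← mul_assoc, div_mul_cancel₀ _ hc]
  have h2 : (1 - s / τ)⁻¹ * (1 - s / τ) = 1 := inv_mul_cancel₀ hc
  have h3 : (2 * τ)⁻¹ = 1 / τ / 2 := by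
    field_simp
  rw [h1] at hl
  generalize pd (ambBasis n) (.inr (.inr ())) (fun z => A.leafMatrix p.2.1 z.2.2 z.2.1 I J)
    (p.1, extChartAt (𝓡 n) p.2.1 p.2.1, p.2.2) = a' at hl ⊢
  rw [h3] at hl ⊢
  rw [lamAt_eq, h3]
  -- The `∂_s` term is `-g_u / τ = -2 λ(s) g(s)`, which matches the `λ g` term of `leaf_P`.
  linear_combination 2 * hl - (1 - 1 / τ / 2 * p.2.2) * a' * h2

theorem IsGlobalAmbient.lieFun_totDensity (hτ : 0 < τ) (hA : A.IsGlobalAmbient (2 * τ)⁻¹)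
    (hs : s < τ) {p : ℝ × M × ℝ} (hp : p ∈ A.carrier) :
    lieFun (totI n) (A.flowField τ) (A.totDensity τ) (p, s) =
      -scalar (𝓡 n) (baseBasis n) ((A.slice τ s).metric (uAt τ s p.2.2)) p.2.1
        - laplacian (𝓡 n) (baseBasis n) ((A.slice τ s).metric (uAt τ s p.2.2))
            ((A.slice τ s).leafDensity (lamAt τ s) p.1 (uAt τ s p.2.2)) p.2.1
        + n / (2 * tauAt τ s) := by
  have hc := (one_sub_div_pos hτ hs).ne'
  have hd : MDifferentiableAt (ambI n) 𝓘(ℝ, ℝ) (A.ambDensity (2 * τ)⁻¹) p :=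
    (hA.smooth_density.contMDiffAt (hA.isOpen_carrier.mem_nhds hp)).mdifferentiableAt (by simp)
  have heq : A.totDensity τ =ᶠ[𝓝 (p, s)] fun q => A.ambDensity (2 * τ)⁻¹ q.1 := by
    filter_upwards [eventually_one_sub_div_ne_zero (τ := τ) (f := Prod.snd)
      (a := ((p, s) : (ℝ × M × ℝ) × ℝ)) continuousAt_snd hc] with q hq
    exact A.totDensity_eq hq
  have hcomp : HasMFDerivAt (totI n) 𝓘(ℝ, ℝ) (fun q : (ℝ × M × ℝ) × ℝ => A.ambDensity (2 * τ)⁻¹ q.1)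
      (p, s) _ :=
    HasMFDerivAt.comp (p, s) (g := A.ambDensity (2 * τ)⁻¹) (f := Prod.fst)
      (hd.hasMFDerivAt) (hasMFDerivAt_fst (I := ambI n) (I' := 𝓘(ℝ, ℝ)) (p, s))
  -- The dilations being defined is what makes `1 - λu` invertible, so that `∂_v φ̃` cancels the
  -- coefficient in front of `v₁`.
  have hB : 1 - (2 * τ)⁻¹ * p.2.2 ≠ 0 := fun h => hA.dilation_defined p hp (by linarith)
  have h1 : lieFun (totI n) (A.flowField τ) (A.totDensity τ) (p, s) =
      (mfderiv (ambI n) 𝓘(ℝ, ℝ) (A.ambDensity (2 * τ)⁻¹) p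
        ((1 - lamAt τ s * uAt τ s p.2.2)⁻¹ * A.totV₁ τ (p, s), (0 : EuclideanSpace ℝ (Fin n)),
          -(1 - lamAt τ s * uAt τ s p.2.2) * (1 - s / τ)⁻¹) : ℝ) := by
    rw [lieFun, heq.mfderiv_eq, hcomp.mfderiv]
    rfl
  have hF := (hA.slice hτ hs).leaf_F (mem_slice_of_mem hc hp)
  simp only at hF
  rw [A.pd_u_slice hc, lamAt_mul_uAt hc] at hF
  rw [h1, hA.mfderiv_ambDensity hp, hA.pd_v_density (mem_coordDomain hp), lamAt_mul_uAt hc]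
  have hv : A.totV₁ τ (p, s) = (1 / 2) * (
      scalar (𝓡 n) (baseBasis n) ((A.slice τ s).metric (uAt τ s p.2.2)) p.2.1
      + 2 * laplacian (𝓡 n) (baseBasis n) ((A.slice τ s).metric (uAt τ s p.2.2))
          ((A.slice τ s).leafDensity (lamAt τ s) p.1 (uAt τ s p.2.2)) p.2.1
      - gradSq (𝓡 n) (baseBasis n) ((A.slice τ s).metric (uAt τ s p.2.2))
          ((A.slice τ s).leafDensity (lamAt τ s) p.1 (uAt τ s p.2.2)) p.2.1
      + 2 * lamAt τ s * ((A.slice τ s).ambDensity (lamAt τ s) (p.1, p.2.1, uAt τ s p.2.2) - n)) := by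
    simp only [totV₁, v₁, weightedScalar, Fintype.card_fin]
    rfl
  have hn : (n : ℝ) / (2 * tauAt τ s) = n * lamAt τ s := by
    rw [lamAt, div_eq_mul_inv]
  rw [hn, hv]
  have hinv := inv_mul_cancel₀ hB
  -- The `∂_v` part of `Y` yields `-v₁` by `hinv`; the `∂_{u(s)}` part is minus half of the right
  -- side of `leaf_F`.
  linear_combination -(1 / 2) * hF - (1 / 2) * (
      scalar (𝓡 n) (baseBasis n) ((A.slice τ s).metric (uAt τ s p.2.2)) p.2.1
      + 2 * laplacian (𝓡 n) (baseBasis n) ((A.slice τ s).metric (uAt τ s p.2.2))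
          ((A.slice τ s).leafDensity (lamAt τ s) p.1 (uAt τ s p.2.2)) p.2.1
      - gradSq (𝓡 n) (baseBasis n) ((A.slice τ s).metric (uAt τ s p.2.2))
          ((A.slice τ s).leafDensity (lamAt τ s) p.1 (uAt τ s p.2.2)) p.2.1
      + 2 * lamAt τ s *
        ((A.slice τ s).ambDensity (lamAt τ s) (p.1, p.2.1, uAt τ s p.2.2) - n)) * hinv

theorem IsGlobalAmbient.lieTensor_totMetric (hτ : 0 < τ) (hA : A.IsGlobalAmbient (2 * τ)⁻¹)
    (hs : s < τ) {p : ℝ × M × ℝ} (hp : p ∈ A.carrier) (X Z : TangentSpace (totI n) (p, s)) :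
    lieTensor (totI n) (totBasis n) (A.flowField τ) (A.totMetric τ) (p, s) X Z =
      -2 * weightedRicci (𝓡 n) (baseBasis n) ((A.slice τ s).metric (uAt τ s p.2.2))
        ((A.slice τ s).leafDensity (lamAt τ s) p.1 (uAt τ s p.2.2)) p.2.1
        (dx n X.1) (dx n Z.1) := by
  have hc := (one_sub_div_pos hτ hs).ne'
  have heq := A.coordTensor_totMetric (P := (p, s)) hc
  have hentry : ∀ I J, (fun y => coordTensor (totI n) (totBasis n) (A.totMetric τ) (p, s) y I J)
      =ᶠ[𝓝 (extChartAt (totI n) (p, s) (p, s))] fun y => totMatrix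
        ((1 - y.2 / τ) • A.leafMatrix p.2.1 y.1.2.2 y.1.2.1) I J := fun I J => by
    filter_upwards [heq] with y hy
    rw [hy]
  -- The terms of the Lie derivative with derivatives of `Y` all vanish: for an index `K` along `M`
  -- the component of `Y` is locally zero, and for any other `K` the metric entry is zero. Hence
  -- `v₁` is never differentiated.
  have hzero' : ∀ K I L, totMatrix ((1 - s / τ) • A.leafMatrix p.2.1 p.2.2
      (extChartAt (𝓡 n) p.2.1 p.2.1)) I K * pd (totBasis n) L
      (coordField (totI n) (totBasis n) (A.flowField τ) (p, s) K)
        (extChartAt (totI n) (p, s) (p, s)) = 0 := fun K I L => by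
    rcases K with (K | K | K) | K
    case inl.inr.inl =>
      rw [pd_congr (coordField_x_eventually_eq_zero _ (fun _ => rfl) _ K), pd_const, mul_zero]
    all_goals rcases I with (I | I | I) | I <;> simp [totMatrix]
  have hzero'' : ∀ K J L, totMatrix ((1 - s / τ) • A.leafMatrix p.2.1 p.2.2
      (extChartAt (𝓡 n) p.2.1 p.2.1)) K J * pd (totBasis n) L
      (coordField (totI n) (totBasis n) (A.flowField τ) (p, s) K)
        (extChartAt (totI n) (p, s) (p, s)) = 0 := fun K J L => by
    rcases K with (K | K | K) | K
    case inl.inr.inl =>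
      rw [pd_congr (coordField_x_eventually_eq_zero _ (fun _ => rfl) _ K), pd_const, mul_zero]
    all_goals simp [totMatrix]
  have hval : coordTensor (totI n) (totBasis n) (A.totMetric τ) (p, s)
      (extChartAt (totI n) (p, s) (p, s)) = totMatrix ((1 - s / τ) • A.leafMatrix p.2.1 p.2.2
        (extChartAt (𝓡 n) p.2.1 p.2.1)) := heq.eq_of_nhds
  have hflow := hA.flow_metric hτ hs hp
  unfold lieTensor
  simp only [hval, hzero', hzero'', add_zero, coordField_flowField, pd_congr (hentry _ _)]
  simp only [extChartAt_tot]
  simp only [hflow]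
  have hrepr : ∀ (W : (ℝ × EuclideanSpace ℝ (Fin n) × ℝ) × ℝ) i,
      (totBasis n).repr W (.inl (.inr (.inl i))) = (baseBasis n).repr (dx n W.1) i := fun W i => by
    simp [totBasis, ambBasis, dx]
  have hsum : ∀ c : Matrix (Fin n) (Fin n) ℝ,
      evalComponents (totI n) (totBasis n) (p, s) (fun I J => totMatrix c I J) X Z =
        ∑ i, ∑ j, c i j * (baseBasis n).repr (dx n X.1) i * (baseBasis n).repr (dx n Z.1) j :=
    fun c => by
      simp [evalComponents, Fintype.sum_sum_type, totMatrix]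
      exact Finset.sum_congr rfl fun i _ => Finset.sum_congr rfl fun j _ =>
        congrArg₂ (fun a b => c i j * a * b) (hrepr X i) (hrepr Z j)
  rw [hsum]
  simp only [weightedRicci, ricci, hess, evalComponents, ← Finset.sum_add_distrib, Finset.mul_sum,
    Matrix.of_apply]
  refine Finset.sum_congr rfl fun i _ => Finset.sum_congr rfl fun j _ => ?_
  rw [show coordTensor (𝓡 n) (baseBasis n) ((A.slice τ s).metric (uAt τ s p.2.2)) p.2.1 =
    (A.slice τ s).leafMatrix p.2.1 (uAt τ s p.2.2) from rfl]
  ring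

end NormalSpace

end WeightedAmbient

end

open WeightedAmbient WeightedAmbient.NormalSpace in
theorem theorem1p9 {n : ℕ} {M : Type*} [TopologicalSpace M]
    [ChartedSpace (EuclideanSpace ℝ (Fin n)) M] [IsManifold (𝓡 n) ∞ M]
    (A : NormalSpace n M) {τ ε : ℝ} (hτ : 0 < τ) (hε : 0 < ε)
    (hA : A.IsGlobalAmbient (2 * τ)⁻¹) :
    (∀ s ∈ Set.Ioo (-ε) τ, (A.slice τ s).IsGlobalAmbient (lamAt τ s)) ∧
    ∀ p ∈ A.carrier, ∀ s ∈ Set.Ioo (-ε) τ,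
      (∀ X Z : TangentSpace (totI n) (p, s),
        lieTensor (totI n) (totBasis n) (A.flowField τ) (A.totMetric τ) (p, s) X Z =
          -2 * weightedRicci (𝓡 n) (baseBasis n) ((A.slice τ s).metric (uAt τ s p.2.2))
            ((A.slice τ s).leafDensity (lamAt τ s) p.1 (uAt τ s p.2.2)) p.2.1
            (dx n X.1) (dx n Z.1)) ∧
      lieFun (totI n) (A.flowField τ) (A.totDensity τ) (p, s) =
        -scalar (𝓡 n) (baseBasis n) ((A.slice τ s).metric (uAt τ s p.2.2)) p.2.1
          - laplacian (𝓡 n) (baseBasis n) ((A.slice τ s).metric (uAt τ s p.2.2))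
              ((A.slice τ s).leafDensity (lamAt τ s) p.1 (uAt τ s p.2.2)) p.2.1
          + n / (2 * tauAt τ s) ∧
      lieFun (totI n) (A.flowField τ) (totTau M τ) (p, s) = -1 := by
  refine ⟨fun s hs => hA.slice hτ hs.2, fun p hp s hs => ⟨fun X Z => ?_, ?_, ?_⟩⟩
  · exact hA.lieTensor_totMetric hτ hs.2 hp X Z
  · exact hA.lieFun_totDensity hτ hs.2 hp
  · exact lieFun_totTau A hτ.ne' p
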